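/- **Setting.** Let $\mathbf h,\mathcal H$ be complex separable Hilbert spaces (inner products antilinear in the first variable), $\{\zeta_j\}$ an orthonormal basis of $\mathcal H$, $\Omega\in\mathcal H$ a unit vector, and $\{U_{s,t}:0\le s\le t<\infty\}$ unitary operators on $\mathbf h\otimes\mathcal H$; put $U_t=U_{0,t}$. For bounded $A$ on $\mathbf h\otimes\mathcal H$ and $u,v\in\mathbf h$ let $A(u,v)\in\mathcal B(\mathcal H)$ be given by $\langle\xi_1,A(u,v)\xi_2\rangle=\langle u\otimes\xi_1,A\,(v\otimes\xi_2)\rangle$, and for $\epsilon\in\mathbb Z_2=\{0,1\}$ put $A^{(0)}=A$, $A^{(1)}=A^*$. For $n$-tuples $\underline a,\underline b$ of times, $\underline\epsilon\in\mathbb Z_2^n$ and $n$-tuples $\underline u,\underline v$ of vectors of $\mathbf h$ write $U^{(\underline\epsilon)}_{\underline a,\underline b}(\underline u,\underline v)=U^{(\epsilon_1)}_{a_1,b_1}(u_1,v_1)\cdots U^{(\epsilon_n)}_{a_n,b_n}(u_n,v_n)$, and $U_{s,t}^{(\underline\epsilon)}(\underline u,\underline v)$ when all $a_i=s$, $b_i=t$.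 Assume: * (Evolution) $U_{r,s}U_{s,t}=U_{r,t}$ for $0\le r\le s\le t$. * (Independence) If $[s_1,t_1)\cap[s_2,t_2)=\emptyset$, then $U_{s_1,t_1}(u_1,v_1)$ commutes with $U_{s_2,t_2}(u_2,v_2)$ and with $U_{s_2,t_2}^*(u_2,v_2)$, and $\langle\Omega,XY\Omega\rangle=\langle\Omega,X\Omega\rangle\langle\Omega,Y\Omega\rangle$ for all $X=U^{(\underline\epsilon)}_{\underline a,\underline b}(\underline u,\underline v)$ with $s_1\le a_1\le b_1\le a_2\le\dots\le b_n\le t_1$ and $Y=U^{(\underline\epsilon')}_{\underline q,\underline r}(\underline p,\underline w)$ with $s_2\le q_1\le r_1\le\dots\le r_m\le t_2$. * (Stationarity) $\langle\Omega,U^{(\underline\epsilon)}_{s,t}(\underline u,\underline v)\Omega\rangle=\langle\Omega,U^{(\underline\epsilon)}_{t-s}(\underline u,\underline v)\Omega\rangle$ for $0\le s\le t$. * (Continuity) $\lim_{t\downarrow0}\langle\Omega,(U_t-1)(u,v)\Omega\rangle=0$ for all $u,v\in\mathbf h$. * (Gaussian condition) $\lim_{t\downarrow0}\frac1t\langle\Omega,(U_t^{(\epsilon_1)}-1)(u_1,v_1)(U_t^{(\epsilon_2)}-1)(u_2,v_2)(U_t^{(\epsilon_3)}-1)(u_3,v_3)\Omega\rangle=0$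 for all $u_i,v_i\in\mathbf h$, $\epsilon_i\in\mathbb Z_2$. * (Minimality) The vectors $U_{s_1,t_1}(u_1,v_1)\cdots U_{s_n,t_n}(u_n,v_n)\Omega$, with $n\ge1$, $0\le s_1\le t_1\le s_2\le\dots\le t_n<\infty$ and $u_i,v_i\in\mathbf h$, are total in $\mathcal H$. Let $G$, with domain $\mathcal D(G)$, be the generator of the semigroup $T_t$ on $\mathbf h$ given by $\langle\phi,T_t\psi\rangle=\langle\Omega,U_t(\phi,\psi)\Omega\rangle$. Let $\mathcal L$, with domain $\mathcal D(\mathcal L)$, be the generator, with respect to the trace norm, of the semigroup $Z_t\rho=\mathrm{Tr}_{\mathcal H}[U_t(\rho\otimes|\Omega\rangle\langle\Omega|)U_t^*]$ on the trace class operators on $\mathbf h$. Assume that $\mathrm{span}\{|u\rangle\langle v|:u,v\in\mathcal D(G)\}\subseteq\mathcal D(\mathcal L)$. Let $M_0$ be the set of all $x=(\underline u,\underline v,\underline\epsilon)$ with $n\ge1$, $u_i\in\mathbf h$, $v_i\in\mathcal D(G)$, $\epsilon_i\in\mathbb Z_2$ ($1\le i\le n$), and for such $x$ put $x_t=U_t^{(\underline\epsilon)}(\underline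 u,\underline v)\Omega-\prod_i\langle u_i,v_i\rangle\,\Omega$. For $x,y\in M_0$ let $K(x,y)=\lim_{t\downarrow0}\frac1t\langle x_t,y_t\rangle$. A *noise space* is a Hilbert space $\mathbf k$ with a map $\eta:M_0\to\mathbf k$ whose range is total in $\mathbf k$ and which satisfies $\langle\eta(x),\eta(y)\rangle=K(x,y)$ for all $x,y\in M_0$ (such a pair is unique up to unitary equivalence). Write $\eta(u,v)=\eta(u,v,0)$ for $u\in\mathbf h$, $v\in\mathcal D(G)$. **Lemma 4.3.** The limits $K(x,y)$ exist for all $x,y\in M_0$, and a noise space exists. For every noise space $(\mathbf k,\eta)$ and every orthonormal basis $\{E_j\}_{j\in J}$ of $\mathbf k$ the following hold. (i) There is a unique family of linear operators $L_j:\mathcal D(G)\to\mathbf h$, $j\in J$, such that $\langle u,L_jv\rangle=\langle E_j,\eta(u,v)\rangle$ for all $u\in\mathbf h$, $v\in\mathcal D(G)$, $j\in J$; and $\sum_j\|L_jv\|^2=-2\,\mathrm{Re}\,\langle v,Gv\rangle$ for all $v\in\mathcal D(G)$. (ii) If $c=(c_j)\in\ell^2(J)$ satisfies $\sum_j\langle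 u,c_jL_jv\rangle=0$ for all $u\in\mathbf h$, $v\in\mathcal D(G)$, then $c=0$. (iii) For all $u,p\in\mathbf h$ and $v,w\in\mathcal D(G)$, $$\langle p,\mathcal L(|w\rangle\langle v|)u\rangle=\langle p,|Gw\rangle\langle v|u\rangle+\langle p,|w\rangle\langle Gv|u\rangle+\sum_j\langle p,|L_jw\rangle\langle L_jv|u\rangle,$$ and for all $v,w\in\mathcal D(G)$ $$\langle v,Gw\rangle+\langle Gv,w\rangle+\sum_j\langle L_jv,L_jw\rangle=0,$$ where both series converge absolutely. -/

import Mathlib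

open Filter Topology TensorProduct
open scoped ENNReal

universe u

namespace UnitaryIncrements

noncomputable section

/-- The Hilbert space tensor product `h ⊗ H`: the completion of the algebraic tensor product. -/
abbrev HTensor (h H : Type*) [NormedAddCommGroup h] [InnerProductSpace ℂ h]
    [NormedAddCommGroup H] [InnerProductSpace ℂ H] : Type _ :=
  UniformSpace.Completion (h ⊗[ℂ] H)

/-! ### The generator of a one-parameter family of bounded operators -/

/-- The (right) derivative at `0` of a one-parameter family `S` of bounded operators: its domain is
the set of all `v` for which `lim_{t ↓ 0} t⁻¹ (S t v - v)` exists in norm, and its value is that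
limit. For a strongly continuous semigroup this is its generator. -/
def generator {X : Type*} [NormedAddCommGroup X] [NormedSpace ℂ X] (S : ℝ → X →L[ℂ] X) :
    X →ₗ.[ℂ] X where
  domain :=
    { carrier := {v | ∃ y, Tendsto (fun t : ℝ => (t : ℂ)⁻¹ • (S t v - v)) (𝓝[>] 0) (𝓝 y)}
      zero_mem' := ⟨0, by simp⟩
      add_mem' := by
        rintro v w ⟨y, hy⟩ ⟨z, hz⟩
        refine ⟨y + z, (hy.add hz).congr fun t => ?_⟩
        rw [map_add, ← smul_add]
        congr 1
        abel
      smul_mem' := by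
        rintro c v ⟨y, hy⟩
        refine ⟨c • y, (hy.const_smul c).congr fun t => ?_⟩
        rw [map_smul, ← smul_sub, smul_comm] }
  toFun :=
    { toFun := fun v => v.2.choose
      map_add' := by
        intro v w
        refine tendsto_nhds_unique (v + w).2.choose_spec
          ((v.2.choose_spec.add w.2.choose_spec).congr fun t => ?_)
        rw [Submodule.coe_add, map_add, ← smul_add]
        congr 1
        abel
      map_smul' := by
        intro c v
        refine tendsto_nhds_unique (c • v).2.choose_spec
          ((v.2.choose_spec.const_smul c).congr fun t => ?_)
        rw [Submodule.coe_smul, map_smul, ← smul_sub, smul_comm] }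

/-- The defining property of the value of the generator. -/
theorem generator_spec {X : Type*} [NormedAddCommGroup X] [NormedSpace ℂ X]
    (S : ℝ → X →L[ℂ] X) (v : (generator S).domain) :
    Tendsto (fun t : ℝ => (t : ℂ)⁻¹ • (S t v - v)) (𝓝[>] 0) (𝓝 (generator S v)) :=
  v.2.choose_spec

/-! ### Trace norm -/

section TraceNorm

variable {h : Type*} [NormedAddCommGroup h] [InnerProductSpace ℂ h]

/-- The trace norm `‖ρ‖₁`, with values in `[0, ∞]`: the supremum of `∑ₖ |⟨φₖ, ρ ψₖ⟩|` over all pairs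
of finite orthonormal families `φ`, `ψ` of the same length. The operator `ρ` is of trace class if
and only if it is finite. -/
def traceNorm (ρ : h →L[ℂ] h) : ℝ≥0∞ :=
  ⨆ (n : ℕ) (φ : Fin n → h) (ψ : Fin n → h) (_ : Orthonormal ℂ φ) (_ : Orthonormal ℂ ψ),
    ∑ k, ‖inner ℂ (φ k) (ρ (ψ k))‖ₑ

end TraceNorm

/-! ### Operators on the tensor product -/

section Operators

variable {h : Type*} [NormedAddCommGroup h] [InnerProductSpace ℂ h]
variable {H : Type*} [NormedAddCommGroup H] [InnerProductSpace ℂ H]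

/-- `tensorLeft u : H → h ⊗ H`, `ξ ↦ u ⊗ ξ`. -/
def tensorLeft (u : h) : H →L[ℂ] HTensor h H :=
  UniformSpace.Completion.toComplL ∘L TensorProduct.mkL ℂ h H u

/-- `tensorRight ξ : h → h ⊗ H`, `u ↦ u ⊗ ξ`. -/
def tensorRight (ξ : H) : h →L[ℂ] HTensor h H :=
  UniformSpace.Completion.toComplL ∘L (TensorProduct.mkL ℂ h H).flip ξ

theorem tensorLeft_apply (u : h) (ξ : H) :
    tensorLeft u ξ = ((u ⊗ₜ[ℂ] ξ : h ⊗[ℂ] H) : HTensor h H) := rfl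

theorem tensorRight_apply (u : h) (ξ : H) :
    tensorRight ξ u = ((u ⊗ₜ[ℂ] ξ : h ⊗[ℂ] H) : HTensor h H) := rfl

variable [CompleteSpace h] [CompleteSpace H]

/-- The partial matrix element `A(u, v) ∈ B(H)` of `A ∈ B(h ⊗ H)`; see `inner_partialElt`. -/
def partialElt (A : HTensor h H →L[ℂ] HTensor h H) (u v : h) : H →L[ℂ] H :=
  ContinuousLinearMap.adjoint (tensorLeft u) ∘L A ∘L tensorLeft v

theorem inner_partialElt (A : HTensor h H →L[ℂ] HTensor h H) (u v : h) (ξ₁ ξ₂ : H) :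
    inner ℂ ξ₁ (partialElt A u v ξ₂) =
      inner ℂ ((u ⊗ₜ[ℂ] ξ₁ : h ⊗[ℂ] H) : HTensor h H)
        (A ((v ⊗ₜ[ℂ] ξ₂ : h ⊗[ℂ] H) : HTensor h H)) := by
  rw [← tensorLeft_apply, ← tensorLeft_apply]
  simp [partialElt, ContinuousLinearMap.adjoint_inner_right]

/-- `A^{(ε)}`: the operator `A` itself if `ε = 0`, its adjoint if `ε = 1`. -/
def epsOp (ε : ZMod 2) (A : HTensor h H →L[ℂ] HTensor h H) : HTensor h H →L[ℂ] HTensor h H :=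
  if ε = 0 then A else ContinuousLinearMap.adjoint A

/-- The operator `ρ ⊗ |Ω⟩⟨Ω|` on `h ⊗ H`; see `tensorProj_apply`. -/
def tensorProj (Ω : H) (ρ : h →L[ℂ] h) : HTensor h H →L[ℂ] HTensor h H :=
  tensorRight Ω ∘L ρ ∘L ContinuousLinearMap.adjoint (tensorRight Ω)

theorem tensorProj_apply (Ω : H) (ρ : h →L[ℂ] h) (x : h) (ξ : H) :
    tensorProj Ω ρ ((x ⊗ₜ[ℂ] ξ : h ⊗[ℂ] H) : HTensor h H) =
      ((ρ x ⊗ₜ[ℂ] (inner ℂ Ω ξ • Ω) : h ⊗[ℂ] H) : HTensor h H) := by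
  have key : ContinuousLinearMap.adjoint (tensorRight (h := h) Ω)
      ((x ⊗ₜ[ℂ] ξ : h ⊗[ℂ] H) : HTensor h H) = inner ℂ Ω ξ • x := by
    refine ext_inner_left ℂ fun y => ?_
    rw [ContinuousLinearMap.adjoint_inner_right, tensorRight_apply,
      UniformSpace.Completion.inner_coe, TensorProduct.inner_tmul, inner_smul_right, mul_comm]
  simp only [tensorProj, ContinuousLinearMap.comp_apply, key, map_smul, tensorRight_apply,
    TensorProduct.tmul_smul, UniformSpace.Completion.coe_smul]

/-- The partial trace over `H`, computed in an orthonormal basis `ζ` of `H`, so that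
`⟨u, Tr_H(B) v⟩ = ∑ⱼ ⟨u ⊗ ζⱼ, B (v ⊗ ζⱼ)⟩`. (For `B` of trace class the series of operators
converges absolutely; the value on other operators is irrelevant.) -/
def partialTrace {κ : Type*} (ζ : HilbertBasis κ ℂ H) (B : HTensor h H →L[ℂ] HTensor h H) :
    h →L[ℂ] h :=
  ∑' j, ContinuousLinearMap.adjoint (tensorRight (ζ j)) ∘L B ∘L tensorRight (ζ j)

end Operators

/-! ### Unitary processes with stationary and independent increments -/

section Increments

variable {h : Type*} [NormedAddCommGroup h] [InnerProductSpace ℂ h] [CompleteSpace h]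
variable {H : Type*} [NormedAddCommGroup H] [InnerProductSpace ℂ H] [CompleteSpace H]

/-- `U_{a,b}^{(ε)}(u, v) = U_{a₁,b₁}^{(ε₁)}(u₁, v₁) ⋯ U_{aₙ,bₙ}^{(εₙ)}(uₙ, vₙ) ∈ B(H)`, the factors
being multiplied in this order. -/
def incProd (U : ℝ → ℝ → HTensor h H →L[ℂ] HTensor h H) {n : ℕ} (a b : Fin n → ℝ)
    (ε : Fin n → ZMod 2) (u v : Fin n → h) : H →L[ℂ] H :=
  (List.ofFn fun k => partialElt (epsOp (ε k) (U (a k) (b k))) (u k) (v k)).prod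

/-- `s ≤ a₁ ≤ b₁ ≤ a₂ ≤ ⋯ ≤ aₙ ≤ bₙ ≤ t`. -/
def IsOrderedIn {n : ℕ} (s t : ℝ) (a b : Fin n → ℝ) : Prop :=
  (∀ k, s ≤ a k ∧ a k ≤ b k ∧ b k ≤ t) ∧ ∀ i j, i < j → b i ≤ a j

/-- The standing assumptions on the family `U s t`, `0 ≤ s ≤ t < ∞`, and the vector `Ω`. (The values
of `U s t` for other `s`, `t` are irrelevant.) -/
structure IsUnitaryIncrementProcess (U : ℝ → ℝ → HTensor h H →L[ℂ] HTensor h H) (Ω : H) :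
    Prop where
  norm_vacuum : ‖Ω‖ = 1
  isUnitary : ∀ s t, 0 ≤ s → s ≤ t → U s t ∈ unitary (HTensor h H →L[ℂ] HTensor h H)
  /-- Evolution. -/
  evolution : ∀ r s t, 0 ≤ r → r ≤ s → s ≤ t → U r s * U s t = U r t
  /-- Independence of increments, first part: commutation over disjoint time intervals. -/
  commute : ∀ s₁ t₁ s₂ t₂, 0 ≤ s₁ → s₁ ≤ t₁ → 0 ≤ s₂ → s₂ ≤ t₂ →
    Disjoint (Set.Ico s₁ t₁) (Set.Ico s₂ t₂) → ∀ u₁ v₁ u₂ v₂ : h,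
      Commute (partialElt (U s₁ t₁) u₁ v₁) (partialElt (U s₂ t₂) u₂ v₂) ∧
      Commute (partialElt (U s₁ t₁) u₁ v₁)
        (partialElt (ContinuousLinearMap.adjoint (U s₂ t₂)) u₂ v₂)
  /-- Independence of increments, second part: vacuum expectations factorize. -/
  independent : ∀ s₁ t₁ s₂ t₂, 0 ≤ s₁ → s₁ ≤ t₁ → 0 ≤ s₂ → s₂ ≤ t₂ →
    Disjoint (Set.Ico s₁ t₁) (Set.Ico s₂ t₂) →
    ∀ (n m : ℕ) (a b : Fin n → ℝ) (q r : Fin m → ℝ),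
      IsOrderedIn s₁ t₁ a b → IsOrderedIn s₂ t₂ q r →
      ∀ (ε : Fin n → ZMod 2) (ε' : Fin m → ZMod 2) (u v : Fin n → h) (p w : Fin m → h),
        inner ℂ Ω ((incProd U a b ε u v * incProd U q r ε' p w) Ω) =
          inner ℂ Ω (incProd U a b ε u v Ω) * inner ℂ Ω (incProd U q r ε' p w Ω)
  /-- Stationarity of increments. -/
  stationary : ∀ s t, 0 ≤ s → s ≤ t → ∀ (n : ℕ) (ε : Fin n → ZMod 2) (u v : Fin n → h),
    inner ℂ Ω (incProd U (fun _ => s) (fun _ => t) ε u v Ω) =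
      inner ℂ Ω (incProd U (fun _ => 0) (fun _ => t - s) ε u v Ω)
  /-- Weak continuity at time zero. -/
  continuity : ∀ u v : h,
    Tendsto (fun t => inner ℂ Ω (partialElt (U 0 t - 1) u v Ω)) (𝓝[>] 0) (𝓝 0)
  /-- The Gaussian condition. -/
  gaussian : ∀ (ε₁ ε₂ ε₃ : ZMod 2) (u₁ u₂ u₃ v₁ v₂ v₃ : h),
    Tendsto (fun t : ℝ => (t : ℂ)⁻¹ * inner ℂ Ω (partialElt (epsOp ε₁ (U 0 t) - 1) u₁ v₁
      (partialElt (epsOp ε₂ (U 0 t) - 1) u₂ v₂ (partialElt (epsOp ε₃ (U 0 t) - 1) u₃ v₃ Ω))))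
      (𝓝[>] 0) (𝓝 0)
  /-- Minimality: the vectors `U_{s₁,t₁}(u₁, v₁) ⋯ U_{sₙ,tₙ}(uₙ, vₙ) Ω` with
  `0 ≤ s₁ ≤ t₁ ≤ s₂ ≤ ⋯ ≤ sₙ ≤ tₙ`, `n ≥ 1`, are total in `H`. -/
  minimal : (Submodule.span ℂ {x : H | ∃ (n : ℕ) (T : ℝ) (s t : Fin n → ℝ) (u v : Fin n → h),
    1 ≤ n ∧ IsOrderedIn 0 T s t ∧ x = incProd U s t 0 u v Ω}).topologicalClosure = ⊤

/-- The expectation semigroup `T_t` on `h`; see `inner_expectation`. -/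
def expectation (U : ℝ → ℝ → HTensor h H →L[ℂ] HTensor h H) (Ω : H) (t : ℝ) : h →L[ℂ] h :=
  ContinuousLinearMap.adjoint (tensorRight Ω) ∘L U 0 t ∘L tensorRight Ω

theorem inner_expectation (U : ℝ → ℝ → HTensor h H →L[ℂ] HTensor h H) (Ω : H) (t : ℝ)
    (φ ψ : h) :
    inner ℂ φ (expectation U Ω t ψ) = inner ℂ Ω (partialElt (U 0 t) φ ψ Ω) := by
  rw [inner_partialElt, ← tensorRight_apply, ← tensorRight_apply]
  simp [expectation, ContinuousLinearMap.adjoint_inner_right]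

/-- `G`, the generator of the expectation semigroup `T_t`. -/
def genG (U : ℝ → ℝ → HTensor h H →L[ℂ] HTensor h H) (Ω : H) : h →ₗ.[ℂ] h :=
  generator (expectation U Ω)

/-- `Z_t ρ = Tr_H [U_t (ρ ⊗ |Ω⟩⟨Ω|) U_t^*]`, for `ρ` of trace class. -/
def semigroupZ (U : ℝ → ℝ → HTensor h H →L[ℂ] HTensor h H) (Ω : H) {κ : Type*}
    (ζ : HilbertBasis κ ℂ H) (t : ℝ) (ρ : h →L[ℂ] h) : h →L[ℂ] h :=
  partialTrace ζ (U 0 t ∘L tensorProj Ω ρ ∘L ContinuousLinearMap.adjoint (U 0 t))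

/-- The graph of the generator of `Z_t` on the trace class operators: `ρ` and `σ` are of trace class
and `t⁻¹ (Z_t ρ - ρ) → σ` in trace norm as `t ↓ 0`. -/
def IsGenZ (U : ℝ → ℝ → HTensor h H →L[ℂ] HTensor h H) (Ω : H) {κ : Type*}
    (ζ : HilbertBasis κ ℂ H) (ρ σ : h →L[ℂ] h) : Prop :=
  traceNorm ρ ≠ ∞ ∧ traceNorm σ ≠ ∞ ∧
    Tendsto (fun t : ℝ => traceNorm ((t : ℂ)⁻¹ • (semigroupZ U Ω ζ t ρ - ρ) - σ)) (𝓝[>] 0) (𝓝 0)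

/-- `D(𝓛)`, the domain of the generator `𝓛` of `Z_t`. -/
def domL (U : ℝ → ℝ → HTensor h H →L[ℂ] HTensor h H) (Ω : H) {κ : Type*}
    (ζ : HilbertBasis κ ℂ H) : Set (h →L[ℂ] h) :=
  {ρ | ∃ σ, IsGenZ U Ω ζ ρ σ}

open Classical in
/-- The generator `𝓛` of `Z_t` (extended by `0` outside its domain). -/
def genL (U : ℝ → ℝ → HTensor h H →L[ℂ] HTensor h H) (Ω : H) {κ : Type*}
    (ζ : HilbertBasis κ ℂ H) (ρ : h →L[ℂ] h) : h →L[ℂ] h :=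
  if hρ : ∃ σ, IsGenZ U Ω ζ ρ σ then hρ.choose else 0

/-- `N₀ = span {|u⟩⟨v| : u, v ∈ D(G)}`. -/
def spanN0 (U : ℝ → ℝ → HTensor h H →L[ℂ] HTensor h H) (Ω : H) : Submodule ℂ (h →L[ℂ] h) :=
  Submodule.span ℂ {ρ | ∃ u ∈ (genG U Ω).domain, ∃ v ∈ (genG U Ω).domain,
    ρ = InnerProductSpace.rankOne ℂ u v}

end Increments

/-! ### The noise space -/

section Noise

/-- The set `M₀` of triples `(u₁ ⊗ ⋯ ⊗ uₙ, v₁ ⊗ ⋯ ⊗ vₙ, (ε₁, …, εₙ))` with `n ≥ 1`, `uᵢ ∈ h`,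
`vᵢ ∈ D` and `εᵢ ∈ {0, 1}`, represented by the factors. -/
structure NoiseIndex {h : Type u} [NormedAddCommGroup h] [InnerProductSpace ℂ h]
    (D : Submodule ℂ h) : Type u where
  n : ℕ
  pos : 1 ≤ n
  left : Fin n → h
  right : Fin n → D
  eps : Fin n → ZMod 2

/-- The element `(u, v, ε)` of `M₀` with one tensor factor. -/
def NoiseIndex.single {h : Type u} [NormedAddCommGroup h] [InnerProductSpace ℂ h]
    {D : Submodule ℂ h} (a : h) (b : D) (ε : ZMod 2) : NoiseIndex D :=
  ⟨1, le_rfl, fun _ => a, fun _ => b, fun _ => ε⟩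

variable {h : Type u} [NormedAddCommGroup h] [InnerProductSpace ℂ h] [CompleteSpace h]
variable {H : Type*} [NormedAddCommGroup H] [InnerProductSpace ℂ H] [CompleteSpace H]

/-- The vector `(U_t^{(ε)} - 1)(u, v) Ω ∈ H` for `(u, v, ε) ∈ M₀`. Here
`U_t^{(ε)}(u, v) = ∏ᵢ U_t^{(εᵢ)}(uᵢ, vᵢ)` and `1(u, v) = ∏ᵢ ⟨uᵢ, vᵢ⟩`. -/
def increment (U : ℝ → ℝ → HTensor h H →L[ℂ] HTensor h H) (Ω : H) (t : ℝ)
    (x : NoiseIndex (genG U Ω).domain) : H :=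
  incProd U (fun _ => 0) (fun _ => t) x.eps x.left (fun i => (x.right i : h)) Ω -
    (∏ i, inner ℂ (x.left i) (x.right i : h)) • Ω

/-- The quantity whose limit as `t ↓ 0` is the kernel `K(x, y)`. -/
def preKernel (U : ℝ → ℝ → HTensor h H →L[ℂ] HTensor h H) (Ω : H)
    (x y : NoiseIndex (genG U Ω).domain) (t : ℝ) : ℂ :=
  (t : ℂ)⁻¹ * inner ℂ (increment U Ω t x) (increment U Ω t y)

/-- The kernel `K(x, y) = lim_{t ↓ 0} t⁻¹ ⟨(U_t^{(ε)} - 1)(u, v) Ω, (U_t^{(ε')} - 1)(p, w) Ω⟩` for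
`x = (u, v, ε)`, `y = (p, w, ε')` in `M₀` (when the limit exists). -/
def noiseKernel (U : ℝ → ℝ → HTensor h H →L[ℂ] HTensor h H) (Ω : H)
    (x y : NoiseIndex (genG U Ω).domain) : ℂ :=
  limUnder (𝓝[>] 0) (preKernel U Ω x y)

/-- The Hilbert space `k` with the map `η` from `M₀` to `k` is a Kolmogorov (minimal)
representation of the kernel `K`. It is unique up to unitary equivalence. -/
structure IsNoiseSpace (U : ℝ → ℝ → HTensor h H →L[ℂ] HTensor h H) (Ω : H)
    {k : Type*} [NormedAddCommGroup k] [InnerProductSpace ℂ k]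
    (η : NoiseIndex (genG U Ω).domain → k) : Prop where
  total : (Submodule.span ℂ (Set.range η)).topologicalClosure = ⊤
  inner_eq : ∀ x y, inner ℂ (η x) (η y) = noiseKernel U Ω x y

end Noise

end

end UnitaryIncrements

open UnitaryIncrements

/-! Write `S_t(u, v) = (U_t - 1)(u, v)`. For rank one `ρ = |w⟩⟨v|`, the matrix element `⟨p, Z_t(ρ)
u⟩` equals `⟨U_t(u, v)Ω, U_t(p, w)Ω⟩`. Differentiating at `0` shows that `t⁻¹⟨S_t(u, v)Ω, S_t(p,
w)Ω⟩` converges to `singleKernel`, which is `⟨p, 𝓛(|w⟩⟨v|)u⟩` minus the two `G`-terms of (iii).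

A general increment is, up to `o(√t)`, a linear combination of vectors `S_t(u, v)Ω`
(`exists_isLittleO_incProd_sub`). Double products of centred factors applied to `Ω` are `o(√t)`:
unitarity bounds their squared norm by a triple product, which the Gaussian condition makes `o(t)`.
An adjoint factor is replaced by `-S_t`, since `(U_t^* - 1)(U_t - 1) = -(U_t^* - 1) - (U_t - 1)`.
The left side here, sliced along a basis of `h`, is an infinite sum of double products, so uniformly
small tails are needed. Conservation of trace supplies them: the limits of the squared slice norms
add up to `-2 Re⟨v, Gv⟩`, the limit of the full squared norm, so no mass escapes
(`exists_finset_norm_le`).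

Hence `K` exists. As a limit of Gram kernels it is positive, and the Kolmogorov construction gives
`(k, η)`. Linear relations between increments modulo `o(√t)` become exact relations in `k`. So `η(u,
v)` is antilinear in `u`, linear in `v` and bounded in `u`, which gives `L_j` by Riesz, and the
vectors `η(u, v)` are already total, which gives (ii). Parseval in `k` turns the formula for
`singleKernel` into the first identity of (iii). Taking `u = p = e_i` there and summing over a basis
gives the second identity and the sum in (i). -/

namespace UnitaryIncrements

open scoped ComplexConjugate
open Asymptotics

set_option linter.unusedSectionVars false

/-! ### Components in a Hilbert sum -/

section HilbertSum

variable {K : Type*} [NormedAddCommGroup K] [InnerProductSpace ℂ K] [CompleteSpace K]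
variable {E : Type*} [NormedAddCommGroup E] [InnerProductSpace ℂ E] [CompleteSpace E]

/-- The components of a vector in a Hilbert sum are given by the adjoints of the embeddings. -/
theorem hasSum_comp_adjoint {ι : Type*} {V : ι → K →ₗᵢ[ℂ] E}
    (hV : IsHilbertSum ℂ (fun _ => K) V) (x : E) :
    HasSum (fun i => V i (ContinuousLinearMap.adjoint (V i).toContinuousLinearMap x)) x := by
  have h1 := hV.hasSum_linearIsometryEquiv_symm (hV.linearIsometryEquiv x)
  rw [LinearIsometryEquiv.symm_apply_apply] at h1
  convert! h1 using 3 with i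
  refine ext_inner_left ℂ fun y => ?_
  rw [ContinuousLinearMap.adjoint_inner_right]
  have h2 := h1.mapL (innerSL ℂ (V i y))
  have h3 := hasSum_single (f := fun j =>
    innerSL ℂ (V i y) (V j (hV.linearIsometryEquiv x j))) i fun j hj => by
      simpa using hV.OrthogonalFamily hj.symm y _
  simpa using h2.unique h3

end HilbertSum

/-! ### Slices, partial matrix elements and partial traces on `h ⊗ H` -/

section Tensor

variable {h : Type*} [NormedAddCommGroup h] [InnerProductSpace ℂ h]
variable {H : Type*} [NormedAddCommGroup H] [InnerProductSpace ℂ H]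

theorem norm_tensorLeft_apply (u : h) (ξ : H) : ‖tensorLeft u ξ‖ = ‖u‖ * ‖ξ‖ := by
  rw [tensorLeft_apply, UniformSpace.Completion.norm_coe, TensorProduct.norm_tmul]

theorem norm_tensorRight_apply (u : h) (ξ : H) : ‖tensorRight ξ u‖ = ‖u‖ * ‖ξ‖ :=
  norm_tensorLeft_apply u ξ

theorem tensorRight_eq_tensorLeft (u : h) (ξ : H) : tensorRight ξ u = tensorLeft u ξ := rfl

theorem inner_tensorLeft (u v : h) (ξ χ : H) :
    inner ℂ (tensorLeft u ξ) (tensorLeft v χ) = inner ℂ u v * inner ℂ ξ χ := by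
  rw [tensorLeft_apply, tensorLeft_apply, UniformSpace.Completion.inner_coe,
    TensorProduct.inner_tmul]

theorem norm_tensorLeft_le (u : h) : ‖(tensorLeft u : H →L[ℂ] HTensor h H)‖ ≤ ‖u‖ :=
  ContinuousLinearMap.opNorm_le_bound _ (norm_nonneg _) fun ξ => (norm_tensorLeft_apply u ξ).le

theorem tensorLeft_add (u v : h) :
    (tensorLeft (u + v) : H →L[ℂ] HTensor h H) = tensorLeft u + tensorLeft v := by
  ext ξ
  simp [tensorLeft_apply, TensorProduct.add_tmul, UniformSpace.Completion.coe_add]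

theorem tensorLeft_smul (c : ℂ) (u : h) :
    (tensorLeft (c • u) : H →L[ℂ] HTensor h H) = c • tensorLeft u := by
  ext ξ
  simp [tensorLeft_apply, ← TensorProduct.smul_tmul']

theorem span_tensorLeft_dense :
    (Submodule.span ℂ {x : HTensor h H | ∃ u ξ, x = tensorLeft u ξ}).topologicalClosure = ⊤ := by
  rw [eq_top_iff]
  intro x _
  refine UniformSpace.Completion.induction_on x (Submodule.isClosed_topologicalClosure _) ?_
  intro a
  refine Submodule.le_topologicalClosure _ ?_
  induction a using TensorProduct.induction_on with
  | zero =>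
    rw [UniformSpace.Completion.coe_zero]
    exact zero_mem _
  | tmul u ξ => exact Submodule.subset_span ⟨u, ξ, rfl⟩
  | add a b ha hb =>
    rw [UniformSpace.Completion.coe_add]
    exact add_mem ha hb

/-- Tensoring with a unit vector on the left, as an isometry. -/
noncomputable def tensorLeftIsometry (u : h) (hu : ‖u‖ = 1) : H →ₗᵢ[ℂ] HTensor h H where
  toLinearMap := (tensorLeft u).toLinearMap
  norm_map' ξ := by
    change ‖tensorLeft u ξ‖ = _
    rw [norm_tensorLeft_apply, hu, one_mul]

/-- Tensoring with a unit vector on the right, as an isometry. -/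
noncomputable def tensorRightIsometry (ξ : H) (hξ : ‖ξ‖ = 1) : h →ₗᵢ[ℂ] HTensor h H where
  toLinearMap := (tensorRight ξ).toLinearMap
  norm_map' u := by
    change ‖tensorRight ξ u‖ = _
    rw [norm_tensorRight_apply, hξ, mul_one]

variable [CompleteSpace h] [CompleteSpace H]

theorem isHilbertSum_tensorLeft {ι : Type*} (e : HilbertBasis ι ℂ h) :
    IsHilbertSum ℂ (fun _ => H) fun i => tensorLeftIsometry (e i) (e.orthonormal.1 i) := by
  refine IsHilbertSum.mk ?_ ?_
  · intro i j hij ξ χ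
    change inner ℂ (tensorLeft (e i) ξ) (tensorLeft (e j) χ) = 0
    rw [inner_tensorLeft, e.orthonormal.2 hij, zero_mul]
  · rw [← span_tensorLeft_dense]
    refine Submodule.topologicalClosure_minimal _ ?_ (Submodule.isClosed_topologicalClosure _)
    rw [Submodule.span_le]
    rintro _ ⟨u, ξ, rfl⟩
    refine mem_closure_of_tendsto ((e.hasSum_repr u).mapL (tensorRight ξ)) (.of_forall fun s => ?_)
    refine Submodule.sum_mem _ fun i _ => ?_
    refine Submodule.mem_iSup_of_mem i ?_
    rw [map_smul]
    exact Submodule.smul_mem _ _ ⟨ξ, rfl⟩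

theorem isHilbertSum_tensorRight {ι : Type*} (e : HilbertBasis ι ℂ H) :
    IsHilbertSum ℂ (fun _ => h) fun i => tensorRightIsometry (e i) (e.orthonormal.1 i) := by
  refine IsHilbertSum.mk ?_ ?_
  · intro i j hij u v
    change inner ℂ (tensorLeft u (e i)) (tensorLeft v (e j)) = 0
    rw [inner_tensorLeft, e.orthonormal.2 hij, mul_zero]
  · rw [← span_tensorLeft_dense]
    refine Submodule.topologicalClosure_minimal _ ?_ (Submodule.isClosed_topologicalClosure _)
    rw [Submodule.span_le]
    rintro _ ⟨u, ξ, rfl⟩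
    refine mem_closure_of_tendsto ((e.hasSum_repr ξ).mapL (tensorLeft u)) (.of_forall fun s => ?_)
    refine Submodule.sum_mem _ fun i _ => ?_
    refine Submodule.mem_iSup_of_mem i ?_
    rw [map_smul]
    exact Submodule.smul_mem _ _ ⟨u, rfl⟩

/-- The slice `(⟨u| ⊗ 1) x` of a vector `x` of `h ⊗ H`. -/
noncomputable def slice (u : h) : HTensor h H →L[ℂ] H := ContinuousLinearMap.adjoint (tensorLeft u)

theorem inner_slice_right (u : h) (ξ : H) (x : HTensor h H) :
    inner ℂ ξ (slice u x) = inner ℂ (tensorLeft u ξ) x :=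
  ContinuousLinearMap.adjoint_inner_right _ _ _

theorem inner_slice_left (u : h) (ξ : H) (x : HTensor h H) :
    inner ℂ (slice u x) ξ = inner ℂ x (tensorLeft u ξ) :=
  ContinuousLinearMap.adjoint_inner_left _ _ _

theorem norm_slice_le (u : h) (x : HTensor h H) : ‖slice u x‖ ≤ ‖u‖ * ‖x‖ := by
  refine (ContinuousLinearMap.le_opNorm _ _).trans ?_
  gcongr
  rw [slice, LinearIsometryEquiv.norm_map]
  exact norm_tensorLeft_le u

theorem slice_tensorLeft (u v : h) (ξ : H) : slice u (tensorLeft v ξ) = inner ℂ u v • ξ := by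
  refine ext_inner_left ℂ fun χ => ?_
  rw [inner_slice_right, inner_tensorLeft, inner_smul_right]

theorem slice_add (u v : h) : (slice (u + v) : HTensor h H →L[ℂ] H) = slice u + slice v := by
  simp [slice, tensorLeft_add]

theorem slice_smul (c : ℂ) (u : h) : (slice (c • u) : HTensor h H →L[ℂ] H) = conj c • slice u := by
  rw [slice, tensorLeft_smul, map_smulₛₗ, slice]

theorem hasSum_tensorLeft_slice {ι : Type*} (e : HilbertBasis ι ℂ h) (x : HTensor h H) :
    HasSum (fun i => tensorLeft (e i) (slice (e i) x)) x :=
  hasSum_comp_adjoint (isHilbertSum_tensorLeft e) x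

theorem hasSum_inner_slice {ι : Type*} (e : HilbertBasis ι ℂ h) (x y : HTensor h H) :
    HasSum (fun i => inner ℂ (slice (e i) x) (slice (e i) y)) (inner ℂ x y) := by
  simpa [inner_slice_left] using (hasSum_tensorLeft_slice e y).mapL (innerSL ℂ x)

theorem summable_norm_sq_adjoint_tensorRight {ι : Type*} (e : HilbertBasis ι ℂ H)
    (x : HTensor h H) :
    Summable fun i => ‖ContinuousLinearMap.adjoint (tensorRight (h := h) (e i)) x‖ ^ 2 := by
  have h1 := hasSum_comp_adjoint (isHilbertSum_tensorRight (h := h) e) x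
  have h2 := ((h1.mapL (innerSL ℂ x)).mapL Complex.reCLM).summable
  refine h2.congr fun i => ?_
  change (inner ℂ x (tensorRight (e i)
    (ContinuousLinearMap.adjoint (tensorRight (h := h) (e i)) x))).re = _
  rw [← ContinuousLinearMap.adjoint_inner_left, inner_self_eq_norm_sq_to_K]
  norm_cast

theorem partialElt_apply (A : HTensor h H →L[ℂ] HTensor h H) (u v : h) (ξ : H) :
    partialElt A u v ξ = slice u (A (tensorLeft v ξ)) := rfl

theorem partialElt_one (u v : h) :
    partialElt (1 : HTensor h H →L[ℂ] HTensor h H) u v = inner ℂ u v • 1 := by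
  ext ξ
  simp [partialElt_apply, slice_tensorLeft]

theorem partialElt_sub (A B : HTensor h H →L[ℂ] HTensor h H) (u v : h) :
    partialElt (A - B) u v = partialElt A u v - partialElt B u v := by
  ext ξ
  simp [partialElt_apply]

theorem adjoint_partialElt (A : HTensor h H →L[ℂ] HTensor h H) (u v : h) :
    ContinuousLinearMap.adjoint (partialElt A u v) =
      partialElt (ContinuousLinearMap.adjoint A) v u := by
  simp [partialElt, ContinuousLinearMap.adjoint_comp, ContinuousLinearMap.comp_assoc]

theorem norm_partialElt_apply_le (A : HTensor h H →L[ℂ] HTensor h H) (u v : h) (ξ : H) :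
    ‖partialElt A u v ξ‖ ≤ ‖u‖ * (‖A‖ * (‖v‖ * ‖ξ‖)) := by
  rw [partialElt_apply, ← norm_tensorLeft_apply]
  refine (norm_slice_le _ _).trans ?_
  gcongr
  exact A.le_opNorm _

/-- The partial trace of a rank one operator. -/
theorem inner_partialTrace_rankOne {κ : Type*} (ζ : HilbertBasis κ ℂ H) (x y : HTensor h H)
    (p u : h) :
    inner ℂ p (partialTrace ζ (InnerProductSpace.rankOne ℂ x y) u) =
      inner ℂ (slice u y) (slice p x) := by
  -- `partialTrace` is a `tsum`, with value `0` unless the series of operators is summable. The norm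
  -- of each rank one term is a product of component norms of `x` and `y`, hence at most the sum of
  -- their squares.
  have hs : Summable fun j => ContinuousLinearMap.adjoint (tensorRight (h := h) (ζ j)) ∘L
      InnerProductSpace.rankOne ℂ x y ∘L tensorRight (ζ j) := by
    refine Summable.of_norm_bounded (g := fun j =>
      ‖ContinuousLinearMap.adjoint (tensorRight (h := h) (ζ j)) x‖ ^ 2 +
      ‖ContinuousLinearMap.adjoint (tensorRight (h := h) (ζ j)) y‖ ^ 2)
      ((summable_norm_sq_adjoint_tensorRight ζ x).add
        (summable_norm_sq_adjoint_tensorRight ζ y)) fun j => ?_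
    rw [InnerProductSpace.rankOne_comp, InnerProductSpace.comp_rankOne,
      InnerProductSpace.norm_rankOne]
    nlinarith [sq_nonneg (‖ContinuousLinearMap.adjoint (tensorRight (h := h) (ζ j)) x‖ -
      ‖ContinuousLinearMap.adjoint (tensorRight (h := h) (ζ j)) y‖),
      sq_nonneg ‖ContinuousLinearMap.adjoint (tensorRight (h := h) (ζ j)) x‖,
      sq_nonneg ‖ContinuousLinearMap.adjoint (tensorRight (h := h) (ζ j)) y‖]
  have h1 := (hs.hasSum.mapL (ContinuousLinearMap.apply ℂ h u)).mapL (innerSL ℂ p)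
  refine (h1.unique ?_)
  convert! ζ.hasSum_inner_mul_inner (slice u y) (slice p x) using 2 with j
  simp only [ContinuousLinearMap.apply_apply, ContinuousLinearMap.comp_apply, innerSL_apply_apply,
    InnerProductSpace.rankOne_apply, map_smul, inner_slice_left,
    inner_slice_right, smul_eq_mul]
  rw [ContinuousLinearMap.adjoint_inner_right, tensorRight_eq_tensorLeft, tensorRight_eq_tensorLeft]

end Tensor

/-! ### Matrix elements and diagonal sums bounded by the trace norm -/

section TraceNorm

variable {h : Type*} [NormedAddCommGroup h] [InnerProductSpace ℂ h]

theorem sum_enorm_inner_le_traceNorm {ι : Type*} (ρ : h →L[ℂ] h) {φ ψ : ι → h}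
    (hφ : Orthonormal ℂ φ) (hψ : Orthonormal ℂ ψ) (s : Finset ι) :
    ∑ i ∈ s, ‖inner ℂ (φ i) (ρ (ψ i))‖ₑ ≤ traceNorm ρ := by
  have h1 : ∑ k : Fin s.card, ‖inner ℂ (φ (s.equivFin.symm k)) (ρ (ψ (s.equivFin.symm k)))‖ₑ ≤
      traceNorm ρ := by
    have hinj : Function.Injective fun k : Fin s.card => (s.equivFin.symm k : ι) :=
      Subtype.val_injective.comp s.equivFin.symm.injective
    exact le_iSup_of_le s.card (le_iSup_of_le _ (le_iSup_of_le _ (le_iSup_of_le (hφ.comp _ hinj)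
      (le_iSup_of_le (hψ.comp _ hinj) le_rfl))))
  rw [s.equivFin.symm.sum_comp (fun i : s => ‖inner ℂ (φ i) (ρ (ψ i))‖ₑ)] at h1
  rwa [← Finset.sum_coe_sort s]

/-- The normalised vectors are orthonormal families of length one, admissible in the supremum. -/
theorem enorm_inner_le_traceNorm (ρ : h →L[ℂ] h) (p u : h) :
    ‖inner ℂ p (ρ u)‖ₑ ≤ ‖p‖ₑ * ‖u‖ₑ * traceNorm ρ := by
  by_cases hp : p = 0
  · simp [hp]
  by_cases hu : u = 0
  · simp [hu]
  have ho : ∀ x : h, x ≠ 0 → Orthonormal ℂ (fun _ : Unit => ((‖x‖ : ℂ)⁻¹) • x) := fun x hx =>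
    ⟨fun _ => by simp [norm_smul, hx], fun i j hij => (hij (Subsingleton.elim i j)).elim⟩
  have h1 := sum_enorm_inner_le_traceNorm ρ (ho p hp) (ho u hu) Finset.univ
  simp only [Finset.univ_unique, Finset.sum_singleton, map_smul] at h1
  have h2 : inner ℂ p (ρ u) =
      (‖p‖ * ‖u‖ : ℂ) * inner ℂ ((‖p‖ : ℂ)⁻¹ • p) ((‖u‖ : ℂ)⁻¹ • ρ u) := by
    have hp' : (‖p‖ : ℂ) ≠ 0 := by simpa using hp
    have hu' : (‖u‖ : ℂ) ≠ 0 := by simpa using hu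
    rw [inner_smul_left, inner_smul_right]
    simp only [map_inv₀, Complex.conj_ofReal]
    field_simp
  rw [h2, enorm_mul, enorm_mul]
  have hn : ∀ x : h, ‖(‖x‖ : ℂ)‖ₑ = ‖x‖ₑ := fun x => by
    rw [← enorm_norm, Complex.norm_real, norm_norm, enorm_norm]
  rw [hn, hn]
  gcongr

end TraceNorm

/-! ### Vectors of order `√t` -/

section Sqrt

variable {H : Type*} [NormedAddCommGroup H] [InnerProductSpace ℂ H]

theorem tendsto_inv_mul_inner_zero {a b : ℝ → H} (ha : a =O[𝓝[>] 0] Real.sqrt)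
    (hb : b =o[𝓝[>] 0] Real.sqrt) :
    Tendsto (fun t : ℝ => (t : ℂ)⁻¹ * inner ℂ (a t) (b t)) (𝓝[>] 0) (𝓝 0) := by
  have h1 : (fun t => inner ℂ (a t) (b t)) =o[𝓝[>] 0] fun t : ℝ => √t * √t := by
    refine IsBigO.trans_isLittleO ?_ (ha.norm_left.mul_isLittleO hb.norm_left)
    exact IsBigO.of_bound 1 (.of_forall fun t => by
      simpa using norm_inner_le_norm (𝕜 := ℂ) (a t) (b t))
  have h2 : (fun t => inner ℂ (a t) (b t)) =o[𝓝[>] 0] fun t : ℝ => (t : ℂ) := by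
    refine h1.trans_isBigO (IsBigO.of_bound 1 ?_)
    filter_upwards [self_mem_nhdsWithin] with t ht
    rw [Real.mul_self_sqrt (le_of_lt ht)]
    simp
  refine h2.tendsto_div_nhds_zero.congr fun t => ?_
  rw [div_eq_inv_mul]

theorem tendsto_inv_mul_inner_zero' {a b : ℝ → H} (ha : a =o[𝓝[>] 0] Real.sqrt)
    (hb : b =O[𝓝[>] 0] Real.sqrt) :
    Tendsto (fun t : ℝ => (t : ℂ)⁻¹ * inner ℂ (a t) (b t)) (𝓝[>] 0) (𝓝 0) := by
  have h1 := (Complex.continuous_conj.tendsto _).comp (tendsto_inv_mul_inner_zero hb ha)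
  rw [map_zero] at h1
  refine h1.congr fun t => ?_
  simp

theorem isLittleO_sqrt_of_norm_sq_le {a : ℝ → H} {z : ℝ → ℂ} {C : ℝ}
    (ha : ∀ᶠ t in 𝓝[>] (0 : ℝ), ‖a t‖ ^ 2 ≤ C * ‖z t‖)
    (hz : Tendsto (fun t : ℝ => (t : ℂ)⁻¹ * z t) (𝓝[>] 0) (𝓝 0)) :
    a =o[𝓝[>] 0] Real.sqrt := by
  rw [isLittleO_iff]
  intro c hc
  have h1 := (hz.norm.const_mul C)
  rw [norm_zero, mul_zero] at h1
  filter_upwards [ha, h1.eventually_lt_const (sq_pos_of_pos hc), self_mem_nhdsWithin]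
    with t h1 h2 ht
  have ht0 : (0 : ℝ) < t := ht
  rw [norm_mul, norm_inv, Complex.norm_real, Real.norm_of_nonneg ht0.le] at h2
  rw [Real.norm_of_nonneg (Real.sqrt_nonneg t)]
  refine abs_le_of_sq_le_sq' ?_ (by positivity) |>.2
  rw [mul_pow, Real.sq_sqrt ht0.le]
  refine h1.trans ?_
  have h3 : C * ‖z t‖ = C * (t⁻¹ * ‖z t‖) * t := by field_simp
  rw [h3]
  exact mul_le_mul_of_nonneg_right h2.le ht0.le

theorem isBigO_sqrt_of_tendsto {a : ℝ → H} {z : ℂ}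
    (h : Tendsto (fun t : ℝ => (t : ℂ)⁻¹ * inner ℂ (a t) (a t)) (𝓝[>] 0) (𝓝 z)) :
    a =O[𝓝[>] 0] Real.sqrt := by
  refine IsBigO.of_bound (√(‖z‖ + 1)) ?_
  filter_upwards [h.norm.eventually_lt_const (lt_add_one ‖z‖), self_mem_nhdsWithin] with t h1 ht
  have ht0 : (0 : ℝ) < t := ht
  rw [norm_mul, norm_inv, Complex.norm_real, Real.norm_of_nonneg ht0.le,
    inner_self_eq_norm_sq_to_K, norm_pow] at h1
  simp only [Complex.coe_algebraMap, Complex.norm_real, norm_norm] at h1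
  rw [Real.norm_of_nonneg (Real.sqrt_nonneg t), ← Real.sqrt_mul (by positivity)]
  refine Real.le_sqrt_of_sq_le ?_
  have h3 : ‖a t‖ ^ 2 = t⁻¹ * ‖a t‖ ^ 2 * t := by field_simp
  rw [h3]
  exact mul_le_mul_of_nonneg_right h1.le ht0.le

end Sqrt

variable {h : Type u} [NormedAddCommGroup h] [InnerProductSpace ℂ h] [CompleteSpace h]
variable {H : Type*} [NormedAddCommGroup H] [InnerProductSpace ℂ H] [CompleteSpace H]

/-! ### Estimates for `A - 1` with `A` unitary -/

section Unitary

theorem norm_le_one_of_mem_unitary {A : HTensor h H →L[ℂ] HTensor h H}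
    (hA : A ∈ unitary (HTensor h H →L[ℂ] HTensor h H)) : ‖A‖ ≤ 1 :=
  ContinuousLinearMap.opNorm_le_bound _ zero_le_one fun x =>
    (ContinuousLinearMap.norm_map_of_mem_unitary hA x).le.trans_eq (one_mul _).symm

/-- Since `‖A x‖ = ‖x‖`, the quadratic term cancels. A squared norm is thus expressed by a quantity
linear in `A - 1`. -/
theorem norm_sub_one_apply_sq {A : HTensor h H →L[ℂ] HTensor h H}
    (hA : A ∈ unitary (HTensor h H →L[ℂ] HTensor h H)) (x : HTensor h H) :
    ‖(A - 1) x‖ ^ 2 = -2 * (inner ℂ x ((A - 1) x)).re := by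
  have h1 : inner ℂ (A x) (A x) = inner ℂ x x :=
    ContinuousLinearMap.inner_map_map_of_mem_unitary hA x x
  have h2 : (inner ℂ ((A - 1) x) ((A - 1) x) : ℂ) = -(inner ℂ x ((A - 1) x) +
      conj (inner ℂ x ((A - 1) x))) := by
    simp only [sub_apply, one_apply_eq_self, inner_sub_left,
      inner_sub_right, h1, inner_conj_symm, map_sub]
    ring
  rw [inner_self_eq_norm_sq_to_K] at h2
  have h3 := congrArg Complex.re h2
  simp only [Complex.neg_re, Complex.add_re, Complex.conj_re] at h3
  rw [show (‖(A - 1) x‖ ^ 2 : ℝ) = ((‖(A - 1) x‖ : ℂ) ^ 2).re by norm_cast]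
  refine h3.trans ?_
  ring

/-- Slicing by `u` costs at most `‖u‖`; what remains is `norm_sub_one_apply_sq` at `v ⊗ ξ`. With `ξ`
itself an increment, the right side is a triple product of increments. -/
theorem norm_partialElt_sub_one_sq_le {A : HTensor h H →L[ℂ] HTensor h H}
    (hA : A ∈ unitary (HTensor h H →L[ℂ] HTensor h H)) (u v : h) (ξ : H) :
    ‖partialElt (A - 1) u v ξ‖ ^ 2 ≤ 2 * ‖u‖ ^ 2 * ‖inner ℂ ξ (partialElt (A - 1) v v ξ)‖ := by
  have h1 : ‖partialElt (A - 1) u v ξ‖ ≤ ‖u‖ * ‖(A - 1) (tensorLeft v ξ)‖ := norm_slice_le _ _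
  have h2 := norm_sub_one_apply_sq hA (tensorLeft v ξ)
  rw [← inner_slice_right, ← partialElt_apply] at h2
  have h3 := (abs_le.1 (Complex.abs_re_le_norm (inner ℂ ξ (partialElt (A - 1) v v ξ)))).1
  calc ‖partialElt (A - 1) u v ξ‖ ^ 2 ≤ (‖u‖ * ‖(A - 1) (tensorLeft v ξ)‖) ^ 2 := by gcongr
    _ = ‖u‖ ^ 2 * (-2 * (inner ℂ ξ (partialElt (A - 1) v v ξ)).re) := by rw [mul_pow, h2]
    _ ≤ ‖u‖ ^ 2 * (2 * ‖inner ℂ ξ (partialElt (A - 1) v v ξ)‖) := by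
        refine mul_le_mul_of_nonneg_left ?_ (sq_nonneg _)
        linarith
    _ = _ := by ring

theorem epsOp_mem_unitary {A : HTensor h H →L[ℂ] HTensor h H}
    (hA : A ∈ unitary (HTensor h H →L[ℂ] HTensor h H)) (ε : ZMod 2) :
    epsOp ε A ∈ unitary (HTensor h H →L[ℂ] HTensor h H) := by
  unfold epsOp
  split_ifs
  · exact hA
  · exact Unitary.star_mem hA

theorem exists_adjoint_epsOp (ε : ZMod 2) : ∃ ε' : ZMod 2, ∀ A : HTensor h H →L[ℂ] HTensor h H,
    ContinuousLinearMap.adjoint (epsOp ε A) = epsOp ε' A := by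
  by_cases hε : ε = 0
  · exact ⟨1, fun A => by simp [epsOp, hε]⟩
  · exact ⟨0, fun A => by simp [epsOp, hε]⟩

theorem norm_partialElt_epsOp_le {A : HTensor h H →L[ℂ] HTensor h H}
    (hA : A ∈ unitary (HTensor h H →L[ℂ] HTensor h H)) (ε : ZMod 2) (u v : h) (ξ : H) :
    ‖partialElt (epsOp ε A - 1) u v ξ‖ ≤ 2 * ‖u‖ * ‖v‖ * ‖ξ‖ := by
  have h1 : ‖epsOp ε A - 1‖ ≤ 2 := by
    refine (norm_sub_le (epsOp ε A) 1).trans ?_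
    have := norm_le_one_of_mem_unitary (epsOp_mem_unitary hA ε)
    have := norm_le_one_of_mem_unitary (one_mem (unitary (HTensor h H →L[ℂ] HTensor h H)))
    linarith
  calc _ ≤ ‖u‖ * (‖epsOp ε A - 1‖ * (‖v‖ * ‖ξ‖)) := norm_partialElt_apply_le _ _ _ _
    _ ≤ ‖u‖ * (2 * (‖v‖ * ‖ξ‖)) := by gcongr
    _ = _ := by ring

/-- Pythagoras: the finite sum is the orthogonal projection of `x` onto the span of the `e i ⊗ H`,
`i ∈ F`. -/
theorem norm_sub_sum_slice_sq {ι : Type*} (e : HilbertBasis ι ℂ h) (F : Finset ι)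
    (x : HTensor h H) :
    ‖x - ∑ i ∈ F, tensorLeft (e i) (slice (e i) x)‖ ^ 2 =
      ‖x‖ ^ 2 - ∑ i ∈ F, ‖slice (e i) x‖ ^ 2 := by
  classical
  set P := ∑ i ∈ F, tensorLeft (e i) (slice (e i) x) with hP
  have h1 : ∀ i ∈ F, slice (e i) P = slice (e i) x := by
    intro i hi
    rw [hP, map_sum, Finset.sum_eq_single i]
    · rw [slice_tensorLeft, inner_self_eq_norm_sq_to_K, e.orthonormal.1 i]
      simp
    · intro j _ hj
      rw [slice_tensorLeft, e.orthonormal.2 hj.symm, zero_smul]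
    · exact fun hi' => (hi' hi).elim
  have h2 : (inner ℂ x P : ℂ) = ((∑ i ∈ F, ‖slice (e i) x‖ ^ 2 : ℝ) : ℂ) := by
    rw [hP, inner_sum]
    push_cast
    refine Finset.sum_congr rfl fun i _ => ?_
    rw [← inner_slice_left, inner_self_eq_norm_sq_to_K]
    rfl
  have h3 : (inner ℂ P P : ℂ) = ((∑ i ∈ F, ‖slice (e i) x‖ ^ 2 : ℝ) : ℂ) := by
    nth_rw 2 [hP]
    rw [inner_sum]
    push_cast
    refine Finset.sum_congr rfl fun i hi => ?_
    rw [← inner_slice_left, h1 i hi, inner_self_eq_norm_sq_to_K]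
    rfl
  rw [inner_self_eq_norm_sq_to_K] at h3
  have h4 : ‖P‖ ^ 2 = ∑ i ∈ F, ‖slice (e i) x‖ ^ 2 := by
    refine Complex.ofReal_injective (Eq.trans ?_ h3)
    push_cast
    rfl
  rw [norm_sub_sq (𝕜 := ℂ), h2, h4]
  simp only [RCLike.re_to_complex, Complex.ofReal_re]
  ring

end Unitary

/-! ### Double products of increments are `o(√t)` -/

variable {U : ℝ → ℝ → HTensor h H →L[ℂ] HTensor h H} {Ω : H}

/-- In the bound of `norm_partialElt_sub_one_sq_le`, moving the inner factor across the inner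
product as an adjoint produces a vacuum expectation of three centred factors, which is `o(t)` by the
Gaussian condition. -/
theorem isLittleO_partialElt_partialElt (hU : IsUnitaryIncrementProcess U Ω) (ε₁ ε₂ : ZMod 2)
    (u₁ v₁ u₂ v₂ : h) :
    (fun t => partialElt (epsOp ε₁ (U 0 t) - 1) u₁ v₁ (partialElt (epsOp ε₂ (U 0 t) - 1) u₂ v₂ Ω))
      =o[𝓝[>] 0] Real.sqrt := by
  obtain ⟨ε₃, h3⟩ := exists_adjoint_epsOp (h := h) (H := H) ε₂
  refine isLittleO_sqrt_of_norm_sq_le (C := 2 * ‖u₁‖ ^ 2) ?_ (hU.gaussian ε₃ ε₁ ε₂ v₂ v₁ u₂ u₂ v₁ v₂)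
  filter_upwards [self_mem_nhdsWithin] with t ht
  refine (norm_partialElt_sub_one_sq_le
    (epsOp_mem_unitary (hU.isUnitary 0 t le_rfl (le_of_lt ht)) ε₁) _ _ _).trans_eq ?_
  rw [← ContinuousLinearMap.adjoint_inner_right (partialElt (epsOp ε₂ (U 0 t) - 1) u₂ v₂),
    adjoint_partialElt, map_sub, h3]
  congr 8
  exact ContinuousLinearMap.adjoint_id

/-! ### The kernel on indices with one tensor factor -/

/-- The limit of `t⁻¹ ⟨(U_t - 1)(u, v) Ω, (U_t - 1)(p, w) Ω⟩` as `t ↓ 0`. -/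
noncomputable def singleKernel (U : ℝ → ℝ → HTensor h H →L[ℂ] HTensor h H) (Ω : H) {κ : Type*}
    (ζ : HilbertBasis κ ℂ H) (u p : h) (v w : (genG U Ω).domain) : ℂ :=
  inner ℂ p (genL U Ω ζ (InnerProductSpace.rankOne ℂ (w : h) (v : h)) u) -
    inner ℂ (genG U Ω v) u * inner ℂ p (w : h) - inner ℂ (v : h) u * inner ℂ p (genG U Ω w)

theorem tendsto_inner_partialElt (hU : IsUnitaryIncrementProcess U Ω) (v : (genG U Ω).domain)
    (φ : h) :
    Tendsto (fun t : ℝ => (t : ℂ)⁻¹ * inner ℂ Ω (partialElt (U 0 t - 1) φ v Ω))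
      (𝓝[>] 0) (𝓝 (inner ℂ φ (genG U Ω v))) := by
  have h1 := (tendsto_const_nhds (x := φ)).inner (𝕜 := ℂ) (generator_spec (expectation U Ω) v)
  refine h1.congr fun t => ?_
  rw [inner_smul_right, inner_sub_right, inner_expectation, partialElt_sub, partialElt_one]
  simp [inner_self_eq_norm_sq_to_K, hU.norm_vacuum]

theorem isGenZ_genL {κ : Type*} {ζ : HilbertBasis κ ℂ H} {ρ : h →L[ℂ] h}
    (hρ : ρ ∈ domL U Ω ζ) : IsGenZ U Ω ζ ρ (genL U Ω ζ ρ) := by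
  have h1 : ∃ σ, IsGenZ U Ω ζ ρ σ := hρ
  rw [genL, dif_pos h1]
  exact h1.choose_spec

/-- Conjugating `|w ⊗ Ω⟩⟨v ⊗ Ω|` by `U_t` leaves a rank one operator, whose partial trace pairs
slices. This links `Z_t` to inner products of increments. -/
theorem inner_semigroupZ_rankOne {κ : Type*} (ζ : HilbertBasis κ ℂ H) (t : ℝ) (u p v w : h) :
    inner ℂ p (semigroupZ U Ω ζ t (InnerProductSpace.rankOne ℂ w v) u) =
      inner ℂ (partialElt (U 0 t) u v Ω) (partialElt (U 0 t) p w Ω) := by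
  have h1 : U 0 t ∘L tensorProj Ω (InnerProductSpace.rankOne ℂ w v) ∘L
      ContinuousLinearMap.adjoint (U 0 t) =
      InnerProductSpace.rankOne ℂ (U 0 t (tensorLeft w Ω)) (U 0 t (tensorLeft v Ω)) := by
    rw [tensorProj, InnerProductSpace.rankOne_comp, InnerProductSpace.comp_rankOne,
      InnerProductSpace.rankOne_comp, InnerProductSpace.comp_rankOne,
      ContinuousLinearMap.adjoint_adjoint, ContinuousLinearMap.adjoint_adjoint]
    rfl
  rw [semigroupZ, h1, inner_partialTrace_rankOne]
  rfl

theorem tendsto_inner_semigroupZ {κ : Type*} {ζ : HilbertBasis κ ℂ H} {ρ σ : h →L[ℂ] h}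
    (hρ : IsGenZ U Ω ζ ρ σ) (p u : h) :
    Tendsto (fun t : ℝ => (t : ℂ)⁻¹ * (inner ℂ p (semigroupZ U Ω ζ t ρ u) - inner ℂ p (ρ u)))
      (𝓝[>] 0) (𝓝 (inner ℂ p (σ u))) := by
  rw [tendsto_iff_edist_tendsto_0]
  have h1 := ENNReal.Tendsto.const_mul (a := ‖p‖ₑ * ‖u‖ₑ) hρ.2.2
    (.inr (ENNReal.mul_ne_top enorm_ne_top enorm_ne_top))
  rw [mul_zero] at h1
  refine tendsto_of_tendsto_of_tendsto_of_le_of_le tendsto_const_nhds h1 (fun t => zero_le)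
    fun t => ?_
  refine le_trans (le_of_eq ?_) (enorm_inner_le_traceNorm _ p u)
  rw [edist_eq_enorm_sub]
  simp

theorem tendsto_singleKernel {κ : Type*} {ζ : HilbertBasis κ ℂ H}
    (hU : IsUnitaryIncrementProcess U Ω)
    (hN : (spanN0 U Ω : Set (h →L[ℂ] h)) ⊆ domL U Ω ζ) (u p : h) (v w : (genG U Ω).domain) :
    Tendsto (fun t : ℝ => (t : ℂ)⁻¹ *
      inner ℂ (partialElt (U 0 t - 1) u v Ω) (partialElt (U 0 t - 1) p w Ω))
      (𝓝[>] 0) (𝓝 (singleKernel U Ω ζ u p v w)) := by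
  have hρ := isGenZ_genL (hN (Submodule.subset_span ⟨w, w.2, v, v.2, rfl⟩))
  have h1 := tendsto_inner_semigroupZ hρ p u
  have h2 := (Complex.continuous_conj.tendsto _).comp (tendsto_inner_partialElt hU v u)
  have h3 := tendsto_inner_partialElt hU w p
  rw [inner_conj_symm] at h2
  refine ((h1.sub (h2.mul_const _)).sub (h3.const_mul _)).congr fun t => ?_
  have hΩ : (inner ℂ Ω Ω : ℂ) = 1 := by
    rw [inner_self_eq_norm_sq_to_K, hU.norm_vacuum]
    simp
  have hS : ∀ a b : h, partialElt (U 0 t - 1) a b Ω =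
      partialElt (U 0 t) a b Ω - inner ℂ a b • Ω := fun a b => by
    rw [partialElt_sub, partialElt_one]
    rfl
  simp only [inner_semigroupZ_rankOne, hS, Function.comp_apply,
    inner_sub_left, inner_sub_right, inner_smul_left, inner_smul_right, hΩ, map_mul, map_sub, map_one,
    map_inv₀, Complex.conj_ofReal, inner_conj_symm, InnerProductSpace.rankOne_apply]
  ring

/-! ### Conservation of trace and tightness -/

/-- By unitarity, `Z_t(|w⟩⟨v|)` and `|w⟩⟨v|` both have trace `⟨v, w⟩`, so the difference quotients
have trace `0`. The trace norm controls all finite diagonal sums uniformly, so this passes to the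
limit `σ`. -/
theorem hasSum_inner_genL {κ : Type*} {ζ : HilbertBasis κ ℂ H}
    (hU : IsUnitaryIncrementProcess U Ω) {v w : h} {σ : h →L[ℂ] h}
    (hσ : IsGenZ U Ω ζ (InnerProductSpace.rankOne ℂ w v) σ) {ι : Type*} (e : HilbertBasis ι ℂ h) :
    HasSum (fun i => inner ℂ (e i) (σ (e i))) 0 := by
  set D : ℝ → h →L[ℂ] h := fun t => (t : ℂ)⁻¹ •
    (semigroupZ U Ω ζ t (InnerProductSpace.rankOne ℂ w v) - InnerProductSpace.rankOne ℂ w v)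
    with hD
  have hΩ : (inner ℂ Ω Ω : ℂ) = 1 := by
    rw [inner_self_eq_norm_sq_to_K, hU.norm_vacuum]
    simp
  have h1 : ∀ t : ℝ, 0 < t → HasSum (fun i => inner ℂ (e i) (D t (e i))) 0 := by
    intro t ht
    have h2 := hasSum_inner_slice e (U 0 t (tensorLeft v Ω)) (U 0 t (tensorLeft w Ω))
    rw [ContinuousLinearMap.inner_map_map_of_mem_unitary (hU.isUnitary 0 t le_rfl ht.le),
      inner_tensorLeft, hΩ, mul_one] at h2
    have h3 := (h2.sub (e.hasSum_inner_mul_inner v w)).mul_left ((t : ℂ)⁻¹)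
    rw [sub_self, mul_zero] at h3
    refine h3.congr_fun fun i => ?_
    simp only [hD, FunLike.coe_smul, Pi.smul_apply, sub_apply, inner_smul_right, inner_sub_right,
      inner_semigroupZ_rankOne, InnerProductSpace.rankOne_apply]
    rfl
  have h2 : Tendsto (fun t => traceNorm (D t - σ)) (𝓝[>] 0) (𝓝 0) := hσ.2.2
  rw [HasSum, SummationFilter.unconditional_filter, EMetric.tendsto_nhds]
  intro δ hδ
  obtain ⟨t, ht1, ht0⟩ := ((h2.eventually_lt_const (ENNReal.half_pos hδ.ne')).and
    self_mem_nhdsWithin).exists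
  have h3 := h1 t ht0
  rw [HasSum, SummationFilter.unconditional_filter, EMetric.tendsto_nhds] at h3
  filter_upwards [h3 _ (ENNReal.half_pos hδ.ne')] with s hs
  rw [edist_zero_right] at hs ⊢
  have h4 : ∑ i ∈ s, inner ℂ (e i) (σ (e i)) =
      ∑ i ∈ s, inner ℂ (e i) (D t (e i)) - ∑ i ∈ s, inner ℂ (e i) ((D t - σ) (e i)) := by
    rw [← Finset.sum_sub_distrib]
    simp
  have h5 := sum_enorm_inner_le_traceNorm (D t - σ) e.orthonormal e.orthonormal s
  calc ‖∑ i ∈ s, inner ℂ (e i) (σ (e i))‖ₑ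
      ≤ ‖∑ i ∈ s, inner ℂ (e i) (D t (e i))‖ₑ +
        ‖∑ i ∈ s, inner ℂ (e i) ((D t - σ) (e i))‖ₑ := by rw [h4]; exact enorm_sub_le
    _ ≤ ‖∑ i ∈ s, inner ℂ (e i) (D t (e i))‖ₑ + traceNorm (D t - σ) := by
        gcongr
        exact (enorm_sum_le _ _).trans h5
    _ < δ / 2 + δ / 2 := ENNReal.add_lt_add hs ht1
    _ = δ := ENNReal.add_halves δ

theorem hasSum_singleKernel {κ : Type*} {ζ : HilbertBasis κ ℂ H}
    (hU : IsUnitaryIncrementProcess U Ω)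
    (hN : (spanN0 U Ω : Set (h →L[ℂ] h)) ⊆ domL U Ω ζ) (v w : (genG U Ω).domain)
    {ι : Type*} (e : HilbertBasis ι ℂ h) :
    HasSum (fun i => singleKernel U Ω ζ (e i) (e i) v w)
      (-inner ℂ (genG U Ω v) (w : h) - inner ℂ (v : h) (genG U Ω w)) := by
  have hρ := isGenZ_genL (hN (Submodule.subset_span ⟨w, w.2, v, v.2, rfl⟩))
  have h1 := ((hasSum_inner_genL hU hρ e).sub (e.hasSum_inner_mul_inner (genG U Ω v) w)).sub
    (e.hasSum_inner_mul_inner (v : h) (genG U Ω w))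
  rwa [zero_sub] at h1

/-- The rescaled vectors `t^{-1/2} (U_t - 1) (v ⊗ Ω)` are tight in the first tensor factor. -/
theorem exists_finset_norm_le {κ : Type*} {ζ : HilbertBasis κ ℂ H}
    (hU : IsUnitaryIncrementProcess U Ω)
    (hN : (spanN0 U Ω : Set (h →L[ℂ] h)) ⊆ domL U Ω ζ) (v : (genG U Ω).domain)
    {ι : Type*} (e : HilbertBasis ι ℂ h) {δ : ℝ} (hδ : 0 < δ) :
    ∃ F : Finset ι, ∀ᶠ t in 𝓝[>] (0 : ℝ), ‖(U 0 t - 1) (tensorLeft (v : h) Ω) -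
      ∑ i ∈ F, tensorLeft (e i) (partialElt (U 0 t - 1) (e i) v Ω)‖ ≤ δ * √t := by
  have hs := (hasSum_singleKernel hU hN v v e).mapL Complex.reCLM
  rw [HasSum, SummationFilter.unconditional_filter] at hs
  have hδ2 := sub_lt_self (Complex.reCLM (-inner ℂ (genG U Ω v) (v : h) -
    inner ℂ (v : h) (genG U Ω v))) (sq_pos_of_pos hδ)
  -- `F` captures all but less than `δ ^ 2` of the total `-2 Re⟨v, Gv⟩`, which is also the limit of
  -- `t⁻¹‖(U_t - 1)(v ⊗ Ω)‖²`. By Pythagoras the remainder outside `F` is then eventually at most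
  -- `δ√t`.
  obtain ⟨F, hF⟩ := (hs.eventually_const_lt hδ2).exists
  refine ⟨F, ?_⟩
  have h1 := (Complex.continuous_re.tendsto _).comp (tendsto_inner_partialElt hU v v)
  have h2 := tendsto_finsetSum F fun i _ => (Complex.continuous_re.tendsto _).comp
    (tendsto_singleKernel hU hN (e i) (e i) v v)
  have h3 := (h1.const_mul (-2)).sub h2
  have hlim : -2 * (inner ℂ (v : h) (genG U Ω v)).re -
      ∑ i ∈ F, (singleKernel U Ω ζ (e i) (e i) v v).re < δ ^ 2 := by
    have h4 : (inner ℂ (genG U Ω v) (v : h)).re = (inner ℂ (v : h) (genG U Ω v)).re := by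
      rw [← inner_conj_symm, Complex.conj_re]
    simp only [Complex.reCLM_apply, Complex.sub_re, Complex.neg_re] at hF
    linarith
  filter_upwards [h3.eventually_lt_const hlim, self_mem_nhdsWithin] with t ht ht0
  have ht0' : (0 : ℝ) < t := ht0
  refine abs_le_of_sq_le_sq' ?_ (by positivity) |>.2
  have h5 := norm_sub_sum_slice_sq e F ((U 0 t - 1) (tensorLeft (v : h) Ω))
  rw [norm_sub_one_apply_sq (hU.isUnitary 0 t le_rfl ht0'.le), ← inner_slice_right] at h5
  change ‖_ - ∑ i ∈ F, tensorLeft (e i) (slice (e i) ((U 0 t - 1) (tensorLeft (v : h) Ω)))‖ ^ 2 ≤ _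
  rw [h5, mul_pow, Real.sq_sqrt ht0'.le]
  have h6 : ∀ z : ℂ, ((t : ℂ)⁻¹ * z).re = t⁻¹ * z.re := fun z => by
    rw [← Complex.ofReal_inv, Complex.re_ofReal_mul]
  have h7 : ∀ i, (inner ℂ (partialElt (U 0 t - 1) (e i) v Ω)
      (partialElt (U 0 t - 1) (e i) v Ω) : ℂ).re =
      ‖slice (e i) ((U 0 t - 1) (tensorLeft (v : h) Ω))‖ ^ 2 := fun i =>
    inner_self_eq_norm_sq (𝕜 := ℂ) _
  simp only [Function.comp_apply, h6, h7, ← Finset.mul_sum] at ht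
  rw [partialElt_apply] at ht
  have h8 := mul_le_mul_of_nonneg_right ht.le ht0'.le
  refine le_trans (le_of_eq ?_) h8
  field_simp

/-- By `U_t^* U_t = 1` the sum is minus the slice by `u` of `(U_t^* - 1)(U_t - 1)(v ⊗ Ω)`. Expanded
over a basis of `h`, finitely many terms are double products, and the tail is small by tightness. -/
theorem isLittleO_adjoint_add {κ : Type*} {ζ : HilbertBasis κ ℂ H}
    (hU : IsUnitaryIncrementProcess U Ω)
    (hN : (spanN0 U Ω : Set (h →L[ℂ] h)) ⊆ domL U Ω ζ) (u : h) (v : (genG U Ω).domain) :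
    (fun t => partialElt (ContinuousLinearMap.adjoint (U 0 t) - 1) u v Ω +
      partialElt (U 0 t - 1) u v Ω) =o[𝓝[>] 0] Real.sqrt := by
  obtain ⟨w, e, -⟩ := exists_hilbertBasis ℂ h
  rw [isLittleO_iff]
  intro c hc
  -- The tail meets a slice of norm at most `‖u‖` and `‖U_t^* - 1‖ ≤ 2`; this `δ` makes its
  -- contribution at most `(c / 2)√t`, and `+ 1` allows `u = 0`.
  obtain ⟨F, hF⟩ := exists_finset_norm_le hU hN v e (δ := c / (4 * (‖u‖ + 1))) (by positivity)
  have h1 : (fun t => ∑ i ∈ F, partialElt (epsOp 1 (U 0 t) - 1) u (e i)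
      (partialElt (epsOp 0 (U 0 t) - 1) (e i) v Ω)) =o[𝓝[>] 0] Real.sqrt :=
    IsLittleO.fun_sum fun i _ => isLittleO_partialElt_partialElt hU 1 0 u (e i) (e i) v
  rw [isLittleO_iff] at h1
  filter_upwards [hF, h1 (half_pos hc), self_mem_nhdsWithin] with t h2 h3 ht
  have hUt := hU.isUnitary 0 t le_rfl (le_of_lt ht)
  rw [Real.norm_of_nonneg (Real.sqrt_nonneg t)] at h3 ⊢
  set A := ContinuousLinearMap.adjoint (U 0 t) with hA
  have e1 : epsOp 1 (U 0 t) = A := by simp [epsOp, hA]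
  have e0 : epsOp 0 (U 0 t) = U 0 t := by simp [epsOp]
  simp only [e1, e0] at h3
  set P := ∑ i ∈ F, tensorLeft (e i) (partialElt (U 0 t - 1) (e i) v Ω) with hP
  set W := (U 0 t - 1) (tensorLeft (v : h) Ω) with hW
  have hAU : ∀ x, A (U 0 t x) = x := fun x => by
    have := hUt.1
    rw [ContinuousLinearMap.star_eq_adjoint] at this
    exact congrArg (fun B : HTensor h H →L[ℂ] HTensor h H => B x) this
  have h4 : partialElt (A - 1) u v Ω + partialElt (U 0 t - 1) u v Ω =
      -(slice u ((A - 1) (W - P)) + ∑ i ∈ F, partialElt (A - 1) u (e i)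
        (partialElt (U 0 t - 1) (e i) v Ω)) := by
    have h5 : ∑ i ∈ F, partialElt (A - 1) u (e i) (partialElt (U 0 t - 1) (e i) v Ω) =
        slice u ((A - 1) P) := by
      rw [hP, map_sum, map_sum]
      rfl
    have h6 : (A - 1) W = -((A - 1) (tensorLeft (v : h) Ω) + W) := by
      simp only [hW, sub_apply, one_apply_eq_self, map_sub, hAU]
      abel
    rw [h5, map_sub, h6, partialElt_apply, partialElt_apply]
    simp only [map_sub, map_neg, map_add]
    rw [← hW]
    abel
  have hA2 : ‖A - 1‖ ≤ 2 := by
    refine (norm_sub_le A 1).trans ?_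
    have := norm_le_one_of_mem_unitary (Unitary.star_mem hUt)
    rw [ContinuousLinearMap.star_eq_adjoint] at this
    have := norm_le_one_of_mem_unitary (one_mem (unitary (HTensor h H →L[ℂ] HTensor h H)))
    linarith
  rw [h4, norm_neg]
  refine (norm_add_le _ _).trans ?_
  have h7 : ‖slice u ((A - 1) (W - P))‖ ≤ c / 2 * √t := by
    calc _ ≤ ‖u‖ * (‖A - 1‖ * ‖W - P‖) :=
          (norm_slice_le _ _).trans (by gcongr; exact (A - 1).le_opNorm _)
      _ ≤ ‖u‖ * (2 * (c / (4 * (‖u‖ + 1)) * √t)) := by gcongr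
      _ ≤ (‖u‖ + 1) * (2 * (c / (4 * (‖u‖ + 1)) * √t)) := by gcongr; linarith
      _ = c / 2 * √t := by field_simp; ring
  linarith

/-! ### Reduction of general increments to single factors; existence of the kernel -/

/-- `Φ_t f = ∑ₓ f(x) xₜ`, where `xₜ` is the increment vector. -/
noncomputable def incrementComb (U : ℝ → ℝ → HTensor h H →L[ℂ] HTensor h H) (Ω : H) (t : ℝ) :
    (NoiseIndex (genG U Ω).domain →₀ ℂ) →ₗ[ℂ] H :=
  Finsupp.linearCombination ℂ (increment U Ω t)

/-- Formal linear combinations of the indices `(u, v, 0)` with one tensor factor. -/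
noncomputable def spanSingles (D : Submodule ℂ h) : Submodule ℂ (NoiseIndex D →₀ ℂ) :=
  Submodule.span ℂ (Set.range fun p : h × D => Finsupp.single (NoiseIndex.single p.1 p.2 0) 1)

theorem increment_single (t : ℝ) (u : h) (v : (genG U Ω).domain) :
    increment U Ω t (NoiseIndex.single u v 0) = partialElt (U 0 t - 1) u v Ω := by
  rw [partialElt_sub, partialElt_one]
  change (incProd U (fun _ : Fin 1 => 0) (fun _ => t) (fun _ => 0) (fun _ => u)
    (fun _ => (v : h)) Ω - (∏ _i : Fin 1, inner ℂ u (v : h)) • Ω) = _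
  simp [incProd, epsOp]

theorem incrementComb_single (t : ℝ) (x : NoiseIndex (genG U Ω).domain) :
    incrementComb U Ω t (Finsupp.single x 1) = increment U Ω t x := by
  simp [incrementComb]

theorem isLittleO_partialElt_incrementComb (hU : IsUnitaryIncrementProcess U Ω) (ε : ZMod 2)
    (u v : h) {f : NoiseIndex (genG U Ω).domain →₀ ℂ} (hf : f ∈ spanSingles (genG U Ω).domain) :
    (fun t => partialElt (epsOp ε (U 0 t) - 1) u v (incrementComb U Ω t f))
      =o[𝓝[>] 0] Real.sqrt := by
  induction hf using Submodule.span_induction with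
  | mem x hx =>
    obtain ⟨p, rfl⟩ := hx
    simp only [incrementComb_single, increment_single]
    simpa [epsOp] using isLittleO_partialElt_partialElt hU ε 0 u v p.1 p.2
  | zero => simp
  | add x y _ _ hx hy => simpa using hx.add hy
  | smul c x _ hx =>
    simp only [map_smul]
    exact hx.const_smul_left c

/-- Increment vectors are linear combinations of the `(U_t - 1)(u, v) Ω` up to `o(√t)`. -/
theorem exists_isLittleO_incProd_sub {κ : Type*} {ζ : HilbertBasis κ ℂ H}
    (hU : IsUnitaryIncrementProcess U Ω)
    (hN : (spanN0 U Ω : Set (h →L[ℂ] h)) ⊆ domL U Ω ζ) (n : ℕ) (ε : Fin n → ZMod 2)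
    (u : Fin n → h) (v : Fin n → (genG U Ω).domain) :
    ∃ f ∈ spanSingles (genG U Ω).domain, (fun t => (incProd U (fun _ => 0) (fun _ => t) ε u
      (fun i => (v i : h)) Ω - (∏ i, inner ℂ (u i) (v i : h)) • Ω) - incrementComb U Ω t f)
      =o[𝓝[>] 0] Real.sqrt := by
  induction n with
  -- The induction starts at the empty product, where the increment is exactly `0`.
  | zero => exact ⟨0, zero_mem _, by simp [incProd]⟩
  | succ n ih =>
    obtain ⟨f, hf, hfo⟩ := ih (fun i => ε i.succ) (fun i => u i.succ) (fun i => v i.succ)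
    obtain ⟨σ, hσ⟩ : ∃ σ : ℂ, (fun t => partialElt (epsOp (ε 0) (U 0 t) - 1) (u 0) (v 0) Ω -
        σ • partialElt (U 0 t - 1) (u 0) (v 0) Ω) =o[𝓝[>] 0] Real.sqrt := by
      by_cases hε : ε 0 = 0
      · exact ⟨1, by simp [hε, epsOp]⟩
      · exact ⟨-1, by simpa [hε, epsOp] using isLittleO_adjoint_add hU hN (u 0) (v 0)⟩
    set c0 : ℂ := inner ℂ (u 0) (v 0 : h) with hc0
    set c : ℂ := ∏ i : Fin n, inner ℂ (u i.succ) (v i.succ : h) with hc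
    -- Product rule: write the first factor as its centred part plus `c0`, and the rest as `c • Ω +
    -- Φ_t f + r t`. The centred part acting on `Φ_t f` or on `r t` is `o(√t)`, and on `c • Ω` it
    -- gives `c * σ` times a single increment.
    refine ⟨c0 • f + (c * σ) • Finsupp.single (NoiseIndex.single (u 0) (v 0) 0) 1,
      add_mem (Submodule.smul_mem _ _ hf)
        (Submodule.smul_mem _ _ (Submodule.subset_span ⟨(u 0, v 0), rfl⟩)), ?_⟩
    set r : ℝ → H := fun t => (incProd U (fun _ => 0) (fun _ => t) (fun i => ε i.succ)
      (fun i => u i.succ) (fun i => (v i.succ : h)) Ω - c • Ω) - incrementComb U Ω t f with hr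
    have h1 : (fun t => partialElt (epsOp (ε 0) (U 0 t) - 1) (u 0) (v 0) (r t))
        =o[𝓝[>] 0] Real.sqrt := by
      refine IsBigO.trans_isLittleO (IsBigO.of_bound (2 * ‖u 0‖ * ‖(v 0 : h)‖) ?_) hfo
      filter_upwards [self_mem_nhdsWithin] with t ht
      exact norm_partialElt_epsOp_le (hU.isUnitary 0 t le_rfl (le_of_lt ht)) _ _ _ _
    have h2 := isLittleO_partialElt_incrementComb hU (ε 0) (u 0) (v 0) hf
    refine ((((hfo.const_smul_left c0).add h1).add h2).add (hσ.const_smul_left c)).congr_left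
      fun t => ?_
    have h3 : incProd U (fun _ => 0) (fun _ => t) ε u (fun i => (v i : h)) Ω =
        partialElt (epsOp (ε 0) (U 0 t)) (u 0) (v 0) (incProd U (fun _ => 0) (fun _ => t)
          (fun i => ε i.succ) (fun i => u i.succ) (fun i => (v i.succ : h)) Ω) := by
      simp [incProd, List.ofFn_succ]
    have h4 : ∀ ξ, partialElt (epsOp (ε 0) (U 0 t)) (u 0) (v 0) ξ =
        partialElt (epsOp (ε 0) (U 0 t) - 1) (u 0) (v 0) ξ + c0 • ξ := fun ξ => by
      rw [partialElt_sub, partialElt_one]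
      simp [hc0]
    have h5 : incProd U (fun _ => 0) (fun _ => t) (fun i => ε i.succ) (fun i => u i.succ)
        (fun i => (v i.succ : h)) Ω = r t + incrementComb U Ω t f + c • Ω := by
      simp [hr]
    rw [h3, h4, Fin.prod_univ_succ, map_add, map_smul, map_smul, incrementComb_single,
      increment_single, h5]
    simp only [map_add, map_smul, Pi.smul_apply]
    rw [← hc, ← hc0]
    simp only [hr]
    module

theorem exists_isLittleO_incrementComb_sub {κ : Type*} {ζ : HilbertBasis κ ℂ H}
    (hU : IsUnitaryIncrementProcess U Ω)
    (hN : (spanN0 U Ω : Set (h →L[ℂ] h)) ⊆ domL U Ω ζ) (x : NoiseIndex (genG U Ω).domain) :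
    ∃ f ∈ spanSingles (genG U Ω).domain,
      (fun t => increment U Ω t x - incrementComb U Ω t f) =o[𝓝[>] 0] Real.sqrt :=
  exists_isLittleO_incProd_sub hU hN x.n x.eps x.left x.right

theorem exists_tendsto_incrementComb {κ : Type*} {ζ : HilbertBasis κ ℂ H}
    (hU : IsUnitaryIncrementProcess U Ω)
    (hN : (spanN0 U Ω : Set (h →L[ℂ] h)) ⊆ domL U Ω ζ)
    {f g : NoiseIndex (genG U Ω).domain →₀ ℂ} (hf : f ∈ spanSingles (genG U Ω).domain)
    (hg : g ∈ spanSingles (genG U Ω).domain) :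
    ∃ z, Tendsto (fun t : ℝ => (t : ℂ)⁻¹ *
      inner ℂ (incrementComb U Ω t f) (incrementComb U Ω t g)) (𝓝[>] 0) (𝓝 z) := by
  induction hf, hg using Submodule.span_induction₂ with
  | mem_mem x y hx hy =>
    obtain ⟨p, rfl⟩ := hx
    obtain ⟨q, rfl⟩ := hy
    simp only [incrementComb_single, increment_single]
    exact ⟨_, tendsto_singleKernel hU hN p.1 q.1 p.2 q.2⟩
  | zero_left y hy => exact ⟨0, by simp⟩
  | zero_right x hx => exact ⟨0, by simp⟩
  | add_left x y z _ _ _ hx hy =>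
    obtain ⟨a, ha⟩ := hx
    obtain ⟨b, hb⟩ := hy
    exact ⟨a + b, by simpa [inner_add_left, mul_add] using ha.add hb⟩
  | add_right x y z _ _ _ hx hy =>
    obtain ⟨a, ha⟩ := hx
    obtain ⟨b, hb⟩ := hy
    exact ⟨a + b, by simpa [inner_add_right, mul_add] using ha.add hb⟩
  | smul_left r x y _ _ hx =>
    obtain ⟨a, ha⟩ := hx
    exact ⟨conj r * a, (ha.const_mul (conj r)).congr fun t => by
      rw [map_smul, inner_smul_left]
      ring⟩
  | smul_right r x y _ _ hx =>
    obtain ⟨a, ha⟩ := hx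
    exact ⟨r * a, (ha.const_mul r).congr fun t => by
      rw [map_smul, inner_smul_right]
      ring⟩

/-- The approximating combinations are `O(√t)`, because their own rescaled norms converge, so
`o(√t)` errors change the inner product only by `o(t)`. -/
theorem tendsto_preKernel {κ : Type*} {ζ : HilbertBasis κ ℂ H}
    (hU : IsUnitaryIncrementProcess U Ω)
    (hN : (spanN0 U Ω : Set (h →L[ℂ] h)) ⊆ domL U Ω ζ) (x y : NoiseIndex (genG U Ω).domain) :
    Tendsto (preKernel U Ω x y) (𝓝[>] 0) (𝓝 (noiseKernel U Ω x y)) := by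
  obtain ⟨f, hf, hfo⟩ := exists_isLittleO_incrementComb_sub hU hN x
  obtain ⟨g, hg, hgo⟩ := exists_isLittleO_incrementComb_sub hU hN y
  obtain ⟨_, hff⟩ := exists_tendsto_incrementComb hU hN hf hf
  obtain ⟨_, hgg⟩ := exists_tendsto_incrementComb hU hN hg hg
  obtain ⟨z, hz⟩ := exists_tendsto_incrementComb hU hN hf hg
  have hfO := isBigO_sqrt_of_tendsto hff
  have hgO := isBigO_sqrt_of_tendsto hgg
  have hlim : Tendsto (preKernel U Ω x y) (𝓝[>] 0) (𝓝 (z + 0 + 0 + 0)) := by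
    refine (((hz.add (tendsto_inv_mul_inner_zero hfO hgo)).add
      (tendsto_inv_mul_inner_zero' hfo hgO)).add
      (tendsto_inv_mul_inner_zero' hfo hgo.isBigO)).congr fun t => ?_
    simp only [preKernel, inner_sub_left, inner_sub_right]
    ring
  exact tendsto_nhds_limUnder ⟨_, hlim⟩

theorem singleKernel_eq_noiseKernel {κ : Type*} {ζ : HilbertBasis κ ℂ H}
    (hU : IsUnitaryIncrementProcess U Ω)
    (hN : (spanN0 U Ω : Set (h →L[ℂ] h)) ⊆ domL U Ω ζ) (u p : h) (v w : (genG U Ω).domain) :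
    noiseKernel U Ω (NoiseIndex.single u v 0) (NoiseIndex.single p w 0) =
      singleKernel U Ω ζ u p v w := by
  refine tendsto_nhds_unique (tendsto_preKernel hU hN _ _) ?_
  refine (tendsto_singleKernel hU hN u p v w).congr fun t => ?_
  rw [preKernel, increment_single, increment_single]

/-! ### Kolmogorov decomposition and existence of the noise space -/

section Kolmogorov

/-- The sesquilinear form on formal linear combinations with kernel `K`. -/
noncomputable def kernelForm {X : Type*} (K : X → X → ℂ) (f g : X →₀ ℂ) : ℂ :=
  f.sum fun x a => g.sum fun y b => conj a * b * K x y

theorem inner_linearCombination {X k : Type*} [SeminormedAddCommGroup k] [InnerProductSpace ℂ k]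
    (η : X → k) (f g : X →₀ ℂ) :
    inner ℂ (Finsupp.linearCombination ℂ η f) (Finsupp.linearCombination ℂ η g) =
      kernelForm (fun x y => inner ℂ (η x) (η y)) f g := by
  simp only [Finsupp.linearCombination_apply, kernelForm, Finsupp.sum, sum_inner, inner_sum,
    inner_smul_left, inner_smul_right, Finset.mul_sum]
  rw [Finset.sum_comm]
  refine Finset.sum_congr rfl fun x _ => Finset.sum_congr rfl fun y _ => ?_
  ring

/-- The semi-inner product on formal linear combinations given by a positive kernel. -/
@[reducible]
noncomputable def kernelCore {X : Type*} (K : X → X → ℂ) (hsymm : ∀ x y, conj (K y x) = K x y)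
    (hpos : ∀ f, 0 ≤ (kernelForm K f f).re) : PreInnerProductSpace.Core ℂ (X →₀ ℂ) where
  inner := kernelForm K
  conj_inner_symm f g := by
    rw [kernelForm, kernelForm, Finsupp.sum_comm]
    simp only [Finsupp.sum, map_sum, map_mul, hsymm, Complex.conj_conj]
    refine Finset.sum_congr rfl fun x _ => Finset.sum_congr rfl fun y _ => ?_
    ring
  re_inner_nonneg := hpos
  add_left f g k := by
    rw [kernelForm, Finsupp.sum_add_index'] <;>
      simp [kernelForm, ← Finsupp.sum_add, add_mul]
  smul_left f g r := by
    rw [kernelForm, Finsupp.sum_smul_index] <;> simp [kernelForm, Finsupp.mul_sum, mul_assoc]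

/-- Kolmogorov decomposition of a positive kernel. -/
theorem exists_kolmogorov {X : Type u} (K : X → X → ℂ) (hsymm : ∀ x y, conj (K y x) = K x y)
    (hpos : ∀ f, 0 ≤ (kernelForm K f f).re) :
    ∃ (k : Type u) (_ : NormedAddCommGroup k) (_ : InnerProductSpace ℂ k) (_ : CompleteSpace k)
      (η : X → k), (Submodule.span ℂ (Set.range η)).topologicalClosure = ⊤ ∧
        ∀ x y, inner ℂ (η x) (η y) = K x y := by
  -- The form may be degenerate; completing the seminormed space also divides out the null vectors.
  let c := kernelCore K hsymm hpos
  let _ : SeminormedAddCommGroup (X →₀ ℂ) := 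
    @InnerProductSpace.Core.toSeminormedAddCommGroup ℂ (X →₀ ℂ) _ _ _ c
  let _ : InnerProductSpace ℂ (X →₀ ℂ) := InnerProductSpace.ofCore c
  refine ⟨UniformSpace.Completion (X →₀ ℂ), inferInstance, inferInstance, inferInstance,
    fun x => ((Finsupp.single x 1 : X →₀ ℂ) : UniformSpace.Completion (X →₀ ℂ)), ?_, ?_⟩
  · rw [eq_top_iff]
    intro z _
    refine UniformSpace.Completion.induction_on z (Submodule.isClosed_topologicalClosure _) ?_
    intro f
    refine Submodule.le_topologicalClosure _ ?_
    induction f using Finsupp.induction_linear with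
    | zero =>
      rw [UniformSpace.Completion.coe_zero]
      exact zero_mem _
    | add f g hf hg =>
      rw [UniformSpace.Completion.coe_add]
      exact add_mem hf hg
    | single x a =>
      have h1 : (Finsupp.single x a : X →₀ ℂ) = a • Finsupp.single x 1 := by simp
      rw [h1, UniformSpace.Completion.coe_smul]
      exact Submodule.smul_mem _ _ (Submodule.subset_span ⟨x, rfl⟩)
  · intro x y
    rw [UniformSpace.Completion.inner_coe]
    change kernelForm K (Finsupp.single x 1) (Finsupp.single y 1) = K x y
    simp [kernelForm]

end Kolmogorov

variable {κ : Type*} {ζ : HilbertBasis κ ℂ H}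

theorem tendsto_kernelForm (hU : IsUnitaryIncrementProcess U Ω)
    (hN : (spanN0 U Ω : Set (h →L[ℂ] h)) ⊆ domL U Ω ζ)
    (f g : NoiseIndex (genG U Ω).domain →₀ ℂ) :
    Tendsto (fun t : ℝ => (t : ℂ)⁻¹ * inner ℂ (incrementComb U Ω t f) (incrementComb U Ω t g))
      (𝓝[>] 0) (𝓝 (kernelForm (noiseKernel U Ω) f g)) := by
  have h1 : Tendsto (fun t => kernelForm (fun x y => preKernel U Ω x y t) f g) (𝓝[>] 0)
      (𝓝 (kernelForm (noiseKernel U Ω) f g)) :=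
    tendsto_finsetSum _ fun x _ => tendsto_finsetSum _ fun y _ =>
      (tendsto_preKernel hU hN x y).const_mul _
  refine h1.congr fun t => ?_
  rw [incrementComb, inner_linearCombination]
  simp only [kernelForm, Finsupp.sum, Finset.mul_sum, preKernel]
  refine Finset.sum_congr rfl fun x _ => Finset.sum_congr rfl fun y _ => ?_
  ring

/-- Hermitian symmetry and positivity of `K` are inherited from the kernels `t⁻¹⟨x_t, y_t⟩`, `t >
0`. -/
theorem exists_isNoiseSpace (hU : IsUnitaryIncrementProcess U Ω)
    (hN : (spanN0 U Ω : Set (h →L[ℂ] h)) ⊆ domL U Ω ζ) :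
    ∃ (k : Type u) (_ : NormedAddCommGroup k) (_ : InnerProductSpace ℂ k) (_ : CompleteSpace k)
      (η : NoiseIndex (genG U Ω).domain → k), IsNoiseSpace U Ω η := by
  have hsymm : ∀ x y, conj (noiseKernel U Ω y x) = noiseKernel U Ω x y := fun x y => by
    refine tendsto_nhds_unique ?_ (tendsto_preKernel hU hN x y)
    refine ((Complex.continuous_conj.tendsto _).comp (tendsto_preKernel hU hN y x)).congr
      fun t => ?_
    simp [preKernel]
  have hpos : ∀ f, 0 ≤ (kernelForm (noiseKernel U Ω) f f).re := fun f => by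
    refine ge_of_tendsto ((Complex.continuous_re.tendsto _).comp (tendsto_kernelForm hU hN f f)) ?_
    filter_upwards [self_mem_nhdsWithin] with t ht
    have ht0 : (0 : ℝ) < t := ht
    rw [Function.comp_apply, ← Complex.ofReal_inv, Complex.re_ofReal_mul]
    exact mul_nonneg (inv_nonneg.2 ht0.le) (inner_self_nonneg (𝕜 := ℂ))
  obtain ⟨k, i1, i2, i3, η, hη1, hη2⟩ := exists_kolmogorov (noiseKernel U Ω) hsymm hpos
  exact ⟨k, i1, i2, i3, η, hη1, hη2⟩

/-! ### The operators `L_j` and their sums -/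

section NoiseSpace

variable {k : Type*} [NormedAddCommGroup k] [InnerProductSpace ℂ k]
variable {η : NoiseIndex (genG U Ω).domain → k}

/-- The squared norm in `k` is the limit of `t⁻¹‖Φ_t f‖²`. This carries relations between increments
over to `η`; the linearity rules below come from combinations that vanish identically. -/
theorem linearCombination_eq_zero (hU : IsUnitaryIncrementProcess U Ω)
    (hN : (spanN0 U Ω : Set (h →L[ℂ] h)) ⊆ domL U Ω ζ) (hη : IsNoiseSpace U Ω η)
    {f : NoiseIndex (genG U Ω).domain →₀ ℂ}
    (hf : (fun t => incrementComb U Ω t f) =o[𝓝[>] 0] Real.sqrt) :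
    Finsupp.linearCombination ℂ η f = 0 := by
  rw [← inner_self_eq_zero (𝕜 := ℂ), inner_linearCombination]
  simp only [hη.inner_eq]
  exact tendsto_nhds_unique (tendsto_kernelForm hU hN f f)
    (tendsto_inv_mul_inner_zero hf.isBigO hf)

theorem noise_add_left (hU : IsUnitaryIncrementProcess U Ω)
    (hN : (spanN0 U Ω : Set (h →L[ℂ] h)) ⊆ domL U Ω ζ) (hη : IsNoiseSpace U Ω η)
    (u u' : h) (v : (genG U Ω).domain) :
    η (NoiseIndex.single (u + u') v 0) =
      η (NoiseIndex.single u v 0) + η (NoiseIndex.single u' v 0) := by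
  have h1 := linearCombination_eq_zero hU hN hη
    (f := Finsupp.single (NoiseIndex.single (u + u') v 0) 1 -
      (Finsupp.single (NoiseIndex.single u v 0) 1 + Finsupp.single (NoiseIndex.single u' v 0) 1))
    (by simp [incrementComb_single, increment_single, partialElt_apply, slice_add])
  simpa [sub_eq_zero] using h1

theorem noise_smul_left (hU : IsUnitaryIncrementProcess U Ω)
    (hN : (spanN0 U Ω : Set (h →L[ℂ] h)) ⊆ domL U Ω ζ) (hη : IsNoiseSpace U Ω η)
    (c : ℂ) (u : h) (v : (genG U Ω).domain) :
    η (NoiseIndex.single (c • u) v 0) = conj c • η (NoiseIndex.single u v 0) := by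
  have h1 := linearCombination_eq_zero hU hN hη
    (f := Finsupp.single (NoiseIndex.single (c • u) v 0) 1 -
      conj c • Finsupp.single (NoiseIndex.single u v 0) 1)
    (by
      simp only [map_sub, map_smul, incrementComb_single, increment_single, partialElt_apply,
        slice_smul]
      simp)
  rw [map_sub, map_smul] at h1
  simpa [sub_eq_zero] using h1

theorem noise_add_right (hU : IsUnitaryIncrementProcess U Ω)
    (hN : (spanN0 U Ω : Set (h →L[ℂ] h)) ⊆ domL U Ω ζ) (hη : IsNoiseSpace U Ω η)
    (u : h) (v v' : (genG U Ω).domain) :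
    η (NoiseIndex.single u (v + v') 0) =
      η (NoiseIndex.single u v 0) + η (NoiseIndex.single u v' 0) := by
  have h1 := linearCombination_eq_zero hU hN hη
    (f := Finsupp.single (NoiseIndex.single u (v + v') 0) 1 -
      (Finsupp.single (NoiseIndex.single u v 0) 1 + Finsupp.single (NoiseIndex.single u v' 0) 1))
    (by
      simp only [map_sub, map_add, incrementComb_single, increment_single, partialElt_apply,
        Submodule.coe_add, tensorLeft_add]
      refine (isLittleO_zero _ _).congr_left fun t => ?_
      simp only [add_apply, map_add]
      abel)
  simpa [sub_eq_zero] using h1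

theorem noise_smul_right (hU : IsUnitaryIncrementProcess U Ω)
    (hN : (spanN0 U Ω : Set (h →L[ℂ] h)) ⊆ domL U Ω ζ) (hη : IsNoiseSpace U Ω η)
    (c : ℂ) (u : h) (v : (genG U Ω).domain) :
    η (NoiseIndex.single u (c • v) 0) = c • η (NoiseIndex.single u v 0) := by
  have h1 := linearCombination_eq_zero hU hN hη
    (f := Finsupp.single (NoiseIndex.single u (c • v) 0) 1 -
      c • Finsupp.single (NoiseIndex.single u v 0) 1)
    (by
      simp only [map_sub, map_smul, incrementComb_single, increment_single, partialElt_apply,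
        Submodule.coe_smul, tensorLeft_smul]
      simp)
  rw [map_sub, map_smul] at h1
  simpa [sub_eq_zero] using h1

theorem norm_noise_sq_le (hU : IsUnitaryIncrementProcess U Ω)
    (hN : (spanN0 U Ω : Set (h →L[ℂ] h)) ⊆ domL U Ω ζ) (hη : IsNoiseSpace U Ω η)
    (u : h) (v : (genG U Ω).domain) :
    ‖η (NoiseIndex.single u v 0)‖ ^ 2 ≤ ‖u‖ ^ 2 * (2 * ‖inner ℂ (v : h) (genG U Ω v)‖) := by
  have h1 := (tendsto_preKernel hU hN (NoiseIndex.single u v 0) (NoiseIndex.single u v 0)).norm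
  have h2 := ((tendsto_inner_partialElt hU v v).norm.const_mul 2).const_mul (‖u‖ ^ 2)
  rw [← hη.inner_eq, inner_self_eq_norm_sq_to_K] at h1
  have h3 : ‖((‖η (NoiseIndex.single u v 0)‖ : ℂ)) ^ 2‖ = ‖η (NoiseIndex.single u v 0)‖ ^ 2 := by
    simp
  rw [← h3]
  refine le_of_tendsto_of_tendsto h1 h2 ?_
  filter_upwards [self_mem_nhdsWithin] with t ht
  have h4 := norm_partialElt_sub_one_sq_le (hU.isUnitary 0 t le_rfl (le_of_lt ht)) u v Ω
  rw [preKernel, increment_single, norm_mul, norm_mul]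
  have h5 := norm_inner_le_norm (𝕜 := ℂ) (partialElt (U 0 t - 1) u v Ω)
    (partialElt (U 0 t - 1) u v Ω)
  calc _ ≤ ‖(t : ℂ)⁻¹‖ * (2 * ‖u‖ ^ 2 * ‖inner ℂ Ω (partialElt (U 0 t - 1) (v : h) v Ω)‖) := by
        gcongr
        nlinarith
    _ = _ := by ring

/-- Riesz representation: `u ↦ ⟨η(u, v), z⟩` is linear, as `η` is antilinear in `u`, and bounded by
`norm_noise_sq_le`. -/
theorem exists_inner_eq_inner_noise (hU : IsUnitaryIncrementProcess U Ω)
    (hN : (spanN0 U Ω : Set (h →L[ℂ] h)) ⊆ domL U Ω ζ) (hη : IsNoiseSpace U Ω η)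
    (z : k) (v : (genG U Ω).domain) :
    ∃ a : h, ∀ u, inner ℂ u a = inner ℂ z (η (NoiseIndex.single u v 0)) := by
  let φ : h →ₗ[ℂ] ℂ :=
    { toFun := fun u => inner ℂ (η (NoiseIndex.single u v 0)) z
      map_add' := fun a b => by rw [noise_add_left hU hN hη, inner_add_left]
      map_smul' := fun c a => by
        rw [noise_smul_left hU hN hη, inner_smul_left, Complex.conj_conj]
        rfl }
  let ψ : h →L[ℂ] ℂ := φ.mkContinuous (√(2 * ‖inner ℂ (v : h) (genG U Ω v)‖) * ‖z‖) fun u => by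
    refine (norm_inner_le_norm (𝕜 := ℂ) _ _).trans ?_
    have h1 : ‖η (NoiseIndex.single u v 0)‖ ≤
        ‖u‖ * √(2 * ‖inner ℂ (v : h) (genG U Ω v)‖) := by
      refine abs_le_of_sq_le_sq' ?_ (by positivity) |>.2
      rw [mul_pow, Real.sq_sqrt (by positivity)]
      exact norm_noise_sq_le hU hN hη u v
    calc _ ≤ (‖u‖ * √(2 * ‖inner ℂ (v : h) (genG U Ω v)‖)) * ‖z‖ := by gcongr
      _ = _ := by ring
  refine ⟨(InnerProductSpace.toDual ℂ h).symm ψ, fun u => ?_⟩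
  rw [← inner_conj_symm, InnerProductSpace.toDual_symm_apply]
  change conj (inner ℂ (η (NoiseIndex.single u v 0)) z) = _
  rw [inner_conj_symm]

theorem exists_noise_operator (hU : IsUnitaryIncrementProcess U Ω)
    (hN : (spanN0 U Ω : Set (h →L[ℂ] h)) ⊆ domL U Ω ζ) (hη : IsNoiseSpace U Ω η) (z : k) :
    ∃ L : (genG U Ω).domain →ₗ[ℂ] h,
      ∀ u v, inner ℂ u (L v) = inner ℂ z (η (NoiseIndex.single u v 0)) := by
  choose a ha using exists_inner_eq_inner_noise hU hN hη z
  refine ⟨{ toFun := a, map_add' := fun v w => ?_, map_smul' := fun c v => ?_ },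
    fun u v => ha v u⟩
  · refine ext_inner_left ℂ fun u => ?_
    rw [inner_add_right, ha, ha, ha, noise_add_right hU hN hη, inner_add_right]
  · refine ext_inner_left ℂ fun u => ?_
    rw [RingHom.id_apply, inner_smul_right, ha, ha, noise_smul_right hU hN hη, inner_smul_right]

/-- Every `η x` lies in the span of the single-factor vectors, by the reduction modulo `o(√t)`, so
these are already total. -/
theorem eq_zero_of_inner_noise (hU : IsUnitaryIncrementProcess U Ω)
    (hN : (spanN0 U Ω : Set (h →L[ℂ] h)) ⊆ domL U Ω ζ) (hη : IsNoiseSpace U Ω η) {z : k}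
    (hz : ∀ u v, inner ℂ z (η (NoiseIndex.single u v 0)) = 0) : z = 0 := by
  have h1 : ∀ f ∈ spanSingles (genG U Ω).domain,
      inner ℂ z (Finsupp.linearCombination ℂ η f) = 0 := by
    intro f hf
    induction hf using Submodule.span_induction with
    | mem x hx =>
      obtain ⟨p, rfl⟩ := hx
      simpa using hz p.1 p.2
    | zero => simp
    | add x y _ _ hx hy => rw [map_add, inner_add_right, hx, hy, add_zero]
    | smul c x _ hx => rw [map_smul, inner_smul_right, hx, mul_zero]
  have h2 : ∀ x, inner ℂ z (η x) = 0 := by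
    intro x
    obtain ⟨f, hf, hfo⟩ := exists_isLittleO_incrementComb_sub hU hN x
    have h3 := linearCombination_eq_zero hU hN hη (f := Finsupp.single x 1 - f)
      (by simpa [incrementComb_single] using hfo)
    rw [map_sub, Finsupp.linearCombination_single, one_smul, sub_eq_zero] at h3
    rw [h3, h1 f hf]
  have h4 : (Submodule.span ℂ (Set.range η)).topologicalClosure ≤ (ℂ ∙ z)ᗮ := by
    refine Submodule.topologicalClosure_minimal _ ?_ (Submodule.isClosed_orthogonal _)
    rw [Submodule.span_le]
    rintro _ ⟨x, rfl⟩
    exact Submodule.mem_orthogonal_singleton_iff_inner_right.2 (h2 x)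
  rw [hη.total] at h4
  exact inner_self_eq_zero.1
    (Submodule.mem_orthogonal_singleton_iff_inner_right.1 (h4 (Submodule.mem_top (x := z))))

variable {ι : Type*} (E : HilbertBasis ι ℂ k) {L : ι → (genG U Ω).domain →ₗ[ℂ] h}

theorem hasSum_inner_noise_operator (hU : IsUnitaryIncrementProcess U Ω)
    (hN : (spanN0 U Ω : Set (h →L[ℂ] h)) ⊆ domL U Ω ζ) (hη : IsNoiseSpace U Ω η)
    (hL : ∀ j u v, inner ℂ u (L j v) = inner ℂ (E j) (η (NoiseIndex.single u v 0)))
    (u p : h) (v w : (genG U Ω).domain) :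
    HasSum (fun j => inner ℂ (L j v) u * inner ℂ p (L j w)) (singleKernel U Ω ζ u p v w) := by
  rw [← singleKernel_eq_noiseKernel hU hN, ← hη.inner_eq]
  convert! E.hasSum_inner_mul_inner (η (NoiseIndex.single u v 0)) (η (NoiseIndex.single p w 0))
    using 2 with j
  rw [hL, ← inner_conj_symm, hL, inner_conj_symm]

/-- Sum the double series `⟨L_j v, e_i⟩⟨e_i, L_j w⟩` in both orders: over `j` first it gives
`singleKernel`, with known sum over `i`; over `i` first it gives `⟨L_j v, L_j w⟩` by Parseval. -/
theorem hasSum_inner_noise_operators (hU : IsUnitaryIncrementProcess U Ω)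
    (hN : (spanN0 U Ω : Set (h →L[ℂ] h)) ⊆ domL U Ω ζ) (hη : IsNoiseSpace U Ω η)
    (hL : ∀ j u v, inner ℂ u (L j v) = inner ℂ (E j) (η (NoiseIndex.single u v 0)))
    (v w : (genG U Ω).domain) :
    HasSum (fun j => inner ℂ (L j v) (L j w))
      (-inner ℂ (genG U Ω v) (w : h) - inner ℂ (v : h) (genG U Ω w)) := by
  obtain ⟨s, e, -⟩ := exists_hilbertBasis ℂ h
  have h1 := fun v w i => hasSum_inner_noise_operator E hU hN hη hL (e i) (e i) v w
  have h2 := fun v w => hasSum_singleKernel hU hN v w e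
  -- Fubini needs absolute summability. For `v = w` the terms are nonnegative and the iterated sum
  -- converges; the mixed case is dominated by the two diagonal ones.
  have hsq : ∀ v, Summable fun p : s × ι => ‖inner ℂ (e p.1) (L p.2 v)‖ ^ 2 := by
    intro v
    have h3 : ∀ i, HasSum (fun j => ‖inner ℂ (e i) (L j v)‖ ^ 2)
        (singleKernel U Ω ζ (e i) (e i) v v).re := fun i => by
      refine ((h1 v v i).mapL Complex.reCLM).congr_fun fun j => ?_
      rw [Complex.reCLM_apply, ← inner_conj_symm (L j v), ← Complex.normSq_eq_conj_mul_self,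
        Complex.ofReal_re, Complex.normSq_eq_norm_sq]
    refine (summable_prod_of_nonneg fun p => by positivity).2 ⟨fun i => (h3 i).summable, ?_⟩
    simp only [(h3 _).tsum_eq]
    exact ((h2 v v).mapL Complex.reCLM).summable
  have hsum : Summable fun p : s × ι => inner ℂ (L p.2 v) (e p.1) * inner ℂ (e p.1) (L p.2 w) := by
    refine Summable.of_norm_bounded ((hsq v).add (hsq w)) fun p => ?_
    rw [norm_mul, norm_inner_symm]
    nlinarith [sq_nonneg (‖inner ℂ (e p.1) (L p.2 v)‖ - ‖inner ℂ (e p.1) (L p.2 w)‖),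
      sq_nonneg ‖inner ℂ (e p.1) (L p.2 v)‖, sq_nonneg ‖inner ℂ (e p.1) (L p.2 w)‖]
  have h5 := hsum.hasSum
  have h6 := h5.prod_fiberwise (h1 v w)
  rw [h6.unique (h2 v w)] at h5
  have h7 := (Equiv.prodComm ι s).hasSum_iff.2 h5
  exact h7.prod_fiberwise fun j => e.hasSum_inner_mul_inner (L j v) (L j w)

end NoiseSpace

end UnitaryIncrements

/-! ### Assembly -/

theorem lemma4p3 {h : Type u} [NormedAddCommGroup h] [InnerProductSpace ℂ h] [CompleteSpace h]
    [TopologicalSpace.SeparableSpace h]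
    {H : Type*} [NormedAddCommGroup H] [InnerProductSpace ℂ H] [CompleteSpace H]
    [TopologicalSpace.SeparableSpace H]
    {κ : Type*} (ζ : HilbertBasis κ ℂ H)
    (U : ℝ → ℝ → HTensor h H →L[ℂ] HTensor h H) (Ω : H)
    (hU : IsUnitaryIncrementProcess U Ω)
    (hN : (spanN0 U Ω : Set (h →L[ℂ] h)) ⊆ domL U Ω ζ) :
    -- the kernel and its noise space exist
    (∀ x y, Tendsto (preKernel U Ω x y) (𝓝[>] 0) (𝓝 (noiseKernel U Ω x y))) ∧
    (∃ (k : Type u) (_ : NormedAddCommGroup k) (_ : InnerProductSpace ℂ k) (_ : CompleteSpace k)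
      (η : NoiseIndex (genG U Ω).domain → k), IsNoiseSpace U Ω η) ∧
    -- for every realization of the noise space and every orthonormal basis of it
    ∀ {k : Type*} [NormedAddCommGroup k] [InnerProductSpace ℂ k] [CompleteSpace k]
      (η : NoiseIndex (genG U Ω).domain → k), IsNoiseSpace U Ω η →
      ∀ {ι : Type*} (E : HilbertBasis ι ℂ k),
      ∃ L : ι → (genG U Ω).domain →ₗ[ℂ] h,
        (∀ j u v, inner ℂ u (L j v) = inner ℂ (E j) (η (NoiseIndex.single u v 0))) ∧
        (∀ L' : ι → (genG U Ω).domain →ₗ[ℂ] h,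
          (∀ j u v, inner ℂ u (L' j v) = inner ℂ (E j) (η (NoiseIndex.single u v 0))) → L' = L) ∧
        (∀ v : (genG U Ω).domain,
          HasSum (fun j => ‖L j v‖ ^ 2) (-2 * (inner ℂ (v : h) (genG U Ω v)).re)) ∧
        (∀ c : lp (fun _ : ι => ℂ) 2,
          (∀ (u : h) (v : (genG U Ω).domain), HasSum (fun j => inner ℂ u (c j • L j v)) 0) →
            c = 0) ∧
        (∀ (u p : h) (v w : (genG U Ω).domain),
          Summable (fun j => inner ℂ p (InnerProductSpace.rankOne ℂ (L j w) (L j v) u)) ∧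
          inner ℂ p (genL U Ω ζ (InnerProductSpace.rankOne ℂ (w : h) (v : h)) u) =
            inner ℂ p (InnerProductSpace.rankOne ℂ (genG U Ω w) (v : h) u) +
            inner ℂ p (InnerProductSpace.rankOne ℂ (w : h) (genG U Ω v) u) +
            ∑' j, inner ℂ p (InnerProductSpace.rankOne ℂ (L j w) (L j v) u)) ∧
        (∀ v w : (genG U Ω).domain,
          Summable (fun j => inner ℂ (L j v) (L j w)) ∧
          inner ℂ (v : h) (genG U Ω w) + inner ℂ (genG U Ω v) (w : h) +
            ∑' j, inner ℂ (L j v) (L j w) = 0) := by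
  refine ⟨tendsto_preKernel hU hN, exists_isNoiseSpace hU hN, ?_⟩
  intro k _ _ _ η hη ι E
  choose L hL using fun j => exists_noise_operator hU hN hη (E j)
  have hsum := hasSum_inner_noise_operators E hU hN hη hL
  refine ⟨L, hL, ?_, ?_, ?_, ?_, ?_⟩
  · intro L' hL'
    funext j
    ext v
    exact ext_inner_left ℂ fun u => by rw [hL', hL]
  · intro v
    have h1 := (hsum v v).mapL Complex.reCLM
    have h2 : (inner ℂ (genG U Ω v) (v : h)).re = (inner ℂ (v : h) (genG U Ω v)).re := by
      rw [← inner_conj_symm, Complex.conj_re]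
    have h3 : Complex.reCLM (-inner ℂ (genG U Ω v) (v : h) - inner ℂ (v : h) (genG U Ω v)) =
        -2 * (inner ℂ (v : h) (genG U Ω v)).re := by
      rw [Complex.reCLM_apply, Complex.sub_re, Complex.neg_re, h2]
      ring
    rw [h3] at h1
    exact h1.congr_fun fun j => (inner_self_eq_norm_sq (𝕜 := ℂ) (L j v)).symm
  · intro c hc
    -- The coordinates are conjugated because the inner product is antilinear in its first argument:
    -- this vector `z` satisfies `⟨z, η(u, v)⟩ = ∑ c_j ⟨u, L_j v⟩`.
    have h1 : E.repr.symm (star c) = 0 := by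
      refine eq_zero_of_inner_noise hU hN hη fun u v => ?_
      refine (E.hasSum_inner_mul_inner _ _).unique ((hc u v).congr_fun fun j => ?_)
      rw [← inner_conj_symm, ← E.repr_apply_apply, LinearIsometryEquiv.apply_symm_apply,
        inner_smul_right, hL]
      simp
    have h2 : star c = 0 := by simpa using h1
    simpa using h2
  · intro u p v w
    have h1 := hasSum_inner_noise_operator E hU hN hη hL u p v w
    have h2 : HasSum (fun j => inner ℂ p (InnerProductSpace.rankOne ℂ (L j w) (L j v) u))
        (singleKernel U Ω ζ u p v w) := by
      simpa only [InnerProductSpace.rankOne_apply, inner_smul_right] using h1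
    refine ⟨h2.summable, ?_⟩
    rw [h2.tsum_eq, singleKernel, InnerProductSpace.rankOne_apply, InnerProductSpace.rankOne_apply,
      inner_smul_right, inner_smul_right]
    ring
  · intro v w
    refine ⟨(hsum v w).summable, ?_⟩
    rw [(hsum v w).tsum_eq]
    ring
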